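/- Let $p$ be a prime number and let $R$ be a commutative noetherian ring of characteristic $p$ which is $F$-finite, i.e. $F_*R$ is a finitely generated $R$-module; here $F^e_*M$ denotes the abelian group $M$ with $R$ acting by $x\cdot u=x^{p^e}u$. For a finitely generated module $M$ over a complete noetherian local ring let $\mathcal J(M)$ be the set of isomorphism classes of indecomposable modules occurring in a decomposition of $M$ into a finite direct sum of indecomposables. Assume that $R$ has complete local finite $F$-representation type, i.e. that for every prime ideal $\mathfrak p\subseteq R$ the set $\bigcup_{e\ge 0}\mathcal J(F^e_*\widehat{R_{\mathfrak p}})$ is finite. Fix integers $a\ge 0$ and $b>0$ such that for all prime ideals $\mathfrak p\subseteq R$ one has $$\mathcal J(F^{a}_*\widehat{R_{\mathfrak p}})=\mathcal J(F^{a+b}_*\widehat{R_{\mathfrak p}})=\mathcal J(F^{a+2b}_*\widehat{R_{\mathfrak p}})=\cdots .$$ Put $F^{(i)}_*R=F^{a+ib}_*R$ and $\mathcal D^{(0)}=\operatorname{End}_R(F^{(0)}_*R)$, and let $$\mathcal D^{(0)}\langle\Phi\rangle=\bigoplus_{i\ge 0}\operatorname{Hom}_R(F^{(0)}_*R,F^{(i)}_*R),$$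 a ring under composition of additive maps $R\to R$. A left $\mathcal D^{(0)}\langle\Phi\rangle$-module $M$ is called unit if the natural map $$\operatorname{Hom}_R(F^{(0)}_*R,F^{(1)}_*R)\otimes_{\mathcal D^{(0)}}M\to M,\qquad \phi\otimes m\mapsto\phi\cdot m,$$ is an isomorphism. Then: 1. The full subcategory of finitely generated unit modules in the category of left $\mathcal D^{(0)}\langle\Phi\rangle$-modules is closed under kernels, cokernels and extensions. 2. In particular, this subcategory, with its induced additive structure, is an abelian category. 3. It is noetherian: every object of this category satisfies the ascending chain condition on subobjects in the category; moreover, for every finitely generated unit module $M$, every ascending chain $N^1\subseteq N^2\subseteq\cdots\subseteq M$ of unit $\mathcal D^{(0)}\langle\Phi\rangle$-submodules stabilizes. -/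

import Mathlib

open CategoryTheory
open scoped DirectSum TensorProduct

universe u v

noncomputable section

namespace PhiMod

/-! ### Frobenius push-forwards and `F`-finite rings -/

/-- `F^e_* M`: the same abelian group as `M`, with `S` acting through the `e`-th iterate of the
Frobenius endomorphism, `x • u = x ^ (p ^ e) u`. -/
def FrobPush (p _e : ℕ) (S : Type*) (M : Type*) [CommRing S] [ExpChar S p] [AddCommGroup M]
    [Module S M] : Type _ := M

section FrobPush

variable (p e : ℕ) (S : Type*) (M : Type*) [CommRing S] [ExpChar S p] [AddCommGroup M] [Module S M]

instance : AddCommGroup (FrobPush p e S M) := inferInstanceAs (AddCommGroup M)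

instance : Module S (FrobPush p e S M) :=
  Module.compHom M (iterateFrobenius S p e)

/-- The identity `M → F^e_* M`. -/
def toFrobPush : M ≃+ FrobPush p e S M := AddEquiv.refl M

theorem smul_toFrobPush (x : S) (u : M) :
    x • toFrobPush p e S M u = toFrobPush p e S M (x ^ p ^ e • u) := rfl

end FrobPush

/-- A ring of characteristic `p` is `F`-finite if it is noetherian and `F_* R` is a finitely
generated `R`-module. -/
def IsFFinite (p : ℕ) (R : Type*) [CommRing R] [ExpChar R p] : Prop :=
  IsNoetherianRing R ∧ Module.Finite R (FrobPush p 1 R R)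

/-! ### Indecomposable components and finite `F`-representation type -/

/-- A module is indecomposable if it is nonzero and is not an internal direct sum of two nonzero
submodules. -/
def IsIndecomposableModule (S : Type*) (N : Type*) [CommRing S] [AddCommGroup N] [Module S N] :
    Prop :=
  Nontrivial N ∧ ∀ A B : Submodule S N, IsCompl A B → A = ⊥ ∨ B = ⊥

/-- `J(M)`: the isomorphism classes of the finitely generated indecomposable modules `N i` that
occur in a decomposition `M ≅ N 0 ⊕ ⋯ ⊕ N (n - 1)`. Over a complete noetherian local ring and for
`M` finitely generated, all such decompositions yield the same classes, by Krull-Schmidt. -/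
def indecComponents (S : Type u) (M : Type u) [CommRing S] [AddCommGroup M] [Module S M] :
    Set (Quotient (isIsomorphicSetoid (ModuleCat.{u} S))) :=
  {c | ∃ (n : ℕ) (N : Fin n → ModuleCat.{u} S),
    (∀ i, Module.Finite S (N i) ∧ IsIndecomposableModule S (N i)) ∧
    Nonempty (M ≃ₗ[S] ((i : Fin n) → N i)) ∧
    ∃ i, c = Quotient.mk (isIsomorphicSetoid (ModuleCat.{u} S)) (N i)}

/-- `J(F^e_* S)`. -/
def frobComponents (p e : ℕ) (S : Type u) [CommRing S] [ExpChar S p] :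
    Set (Quotient (isIsomorphicSetoid (ModuleCat.{u} S))) :=
  indecComponents S (FrobPush p e S S)

/-- Finite `F`-representation type (used for complete local `F`-finite rings): only finitely many
isomorphism classes of indecomposable modules occur in the modules `F^e_* S`, `e ≥ 0`. -/
def HasFFRT (p : ℕ) (S : Type u) [CommRing S] [ExpChar S p] : Prop :=
  (⋃ e : ℕ, frobComponents p e S).Finite

/-- The completion of the local ring `R_P`. -/
abbrev CompletedLocalization {R : Type u} [CommRing R] (P : Ideal R) [P.IsPrime] : Type u :=
  AdicCompletion (IsLocalRing.maximalIdeal (Localization.AtPrime P)) (Localization.AtPrime P)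

theorem completedLocalization_nontrivial {R : Type u} [CommRing R] (P : Ideal R) [P.IsPrime] :
    Nontrivial (CompletedLocalization P) := by
  have hne : (IsLocalRing.maximalIdeal (Localization.AtPrime P) ^ 1 • ⊤ :
      Submodule (Localization.AtPrime P) (Localization.AtPrime P)) ≠ ⊤ := by
    rw [pow_one, smul_eq_mul, Ideal.mul_top]
    exact Ideal.IsPrime.ne_top'
  have : Nontrivial (Localization.AtPrime P ⧸
      (IsLocalRing.maximalIdeal (Localization.AtPrime P) ^ 1 • ⊤ :
        Submodule (Localization.AtPrime P) (Localization.AtPrime P))) :=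
    Submodule.Quotient.nontrivial_iff.mpr hne
  exact (AdicCompletion.eval_surjective
    (IsLocalRing.maximalIdeal (Localization.AtPrime P)) (Localization.AtPrime P) 1).nontrivial

instance completedLocalization_charP (p : ℕ) [Fact p.Prime] {R : Type u} [CommRing R] [CharP R p]
    (P : Ideal R) [P.IsPrime] : CharP (CompletedLocalization P) p := by
  have := completedLocalization_nontrivial P
  have h0 : (p : Localization.AtPrime P) = 0 := by
    rw [← map_natCast (algebraMap R (Localization.AtPrime P)), CharP.cast_eq_zero, map_zero]
  have h : (p : CompletedLocalization P) = 0 := by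
    rw [← map_natCast (algebraMap (Localization.AtPrime P) (CompletedLocalization P)), h0, map_zero]
  obtain ⟨q, hq⟩ := CharP.exists (CompletedLocalization P)
  have hqp : q ∣ p := (CharP.cast_eq_zero_iff _ q p).mp h
  rcases (Nat.dvd_prime (Fact.out : p.Prime)).mp hqp with h1 | h1
  · exact absurd h1 (CharP.char_ne_one (CompletedLocalization P) q)
  · exact h1 ▸ hq

/-- Complete local finite `F`-representation type: `R` is `F`-finite and the completion of `R_P`
has finite `F`-representation type for every prime ideal `P`. -/
def HasCLFFRT (p : ℕ) [Fact p.Prime] (R : Type u) [CommRing R] [CharP R p] : Prop :=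
  IsFFinite p R ∧ ∀ (P : Ideal R) [P.IsPrime], HasFFRT p (CompletedLocalization P)

/-- `a ≥ 0` and `b > 0` are such that, for every prime ideal `P`, the modules
`F^a_*, F^{a+b}_*, F^{a+2b}_*, …` of the completion of `R_P` all have the same indecomposable
components. -/
def IsFFRTPair (p : ℕ) [Fact p.Prime] (R : Type u) [CommRing R] [CharP R p] (a b : ℕ) : Prop :=
  0 < b ∧ ∀ (P : Ideal R) [P.IsPrime] (e : ℕ),
    frobComponents p (a + e * b) (CompletedLocalization P) =
      frobComponents p a (CompletedLocalization P)

/-! ### The ring `D^{(0)}⟨Φ⟩` -/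

section Ring

variable (p a b : ℕ) (R : Type u) [CommRing R]

/-- `Hom_R(F^{(0)}_* R, F^{(i)}_* R)`, where `F^{(i)} = F^{a + i b}`, as a subgroup of the additive
endomorphisms of `R`. For `i = 0` this is `D^{(0)} = End_R(F^a_* R)`. -/
def frobHoms (i : ℕ) : AddSubgroup (AddMonoid.End R) where
  carrier := {φ | ∀ x u : R, φ (x ^ p ^ a * u) = x ^ p ^ (a + i * b) * φ u}
  add_mem' {φ ψ} hφ hψ x u := by
    change φ _ + ψ _ = _ * (φ u + ψ u)
    rw [hφ, hψ, mul_add]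
  zero_mem' x u := by simp
  neg_mem' {φ} hφ x u := by
    change -(φ _) = _ * -(φ u)
    rw [hφ, mul_neg]

variable {p a b R}

theorem mem_frobHoms {i : ℕ} {φ : AddMonoid.End R} :
    φ ∈ frobHoms p a b R i ↔ ∀ x u : R, φ (x ^ p ^ a * u) = x ^ p ^ (a + i * b) * φ u := Iff.rfl

/-- The elements of `frobHoms p a b R i` are exactly the `R`-linear maps
`F^a_* R → F^{a + i b}_* R`. -/
theorem mem_frobHoms_iff_linear [ExpChar R p] {i : ℕ} {φ : AddMonoid.End R} :
    φ ∈ frobHoms p a b R i ↔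
      ∃ f : FrobPush p a R R →ₗ[R] FrobPush p (a + i * b) R R, ∀ u : R,
        f (toFrobPush p a R R u) = toFrobPush p (a + i * b) R R (φ u) := by
  constructor
  · intro h
    exact ⟨{ toFun := fun u => toFrobPush p (a + i * b) R R (φ ((toFrobPush p a R R).symm u))
             map_add' := fun u w => by simp
             map_smul' := fun x u => h x u }, fun u => rfl⟩
  · rintro ⟨f, hf⟩ x u
    apply (toFrobPush p (a + i * b) R R).injective
    have h := f.map_smul x (toFrobPush p a R R u)
    rw [smul_toFrobPush, smul_eq_mul, hf, hf, smul_toFrobPush] at h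
    exact h

theorem frobHoms_mul_mem {i j : ℕ} {φ ψ : AddMonoid.End R} (hφ : φ ∈ frobHoms p a b R i)
    (hψ : ψ ∈ frobHoms p a b R j) : φ * ψ ∈ frobHoms p a b R (i + j) := by
  intro x u
  have e1 : a + j * b = j * b + a := add_comm _ _
  have e2 : j * b + (a + i * b) = a + (i + j) * b := by ring
  change φ (ψ _) = _ * φ (ψ u)
  rw [hψ x u, e1, pow_add, pow_mul,
    hφ (x ^ p ^ (j * b)) (ψ u), ← pow_mul, ← pow_add, e2]

instance : SetLike.GradedMonoid (frobHoms p a b R) where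
  one_mem x u := by simp
  mul_mem _ _ _ _ hφ hψ := frobHoms_mul_mem hφ hψ

variable (p a b R)

/-- The ring `D^{(0)}⟨Φ⟩ = ⨁_{i ≥ 0} Hom_R(F^{(0)}_* R, F^{(i)}_* R)`, with multiplication given
by composition. -/
abbrev DPhi : Type u := ⨁ i : ℕ, frobHoms p a b R i

theorem DPhi.of_mul_of {i j : ℕ} (φ : frobHoms p a b R i) (ψ : frobHoms p a b R j) :
    (DirectSum.of (fun i => frobHoms p a b R i) i φ : DPhi p a b R) *
        DirectSum.of (fun i => frobHoms p a b R i) j ψ =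
      DirectSum.of (fun i => frobHoms p a b R i) (i + j)
        ⟨φ.1 * ψ.1, frobHoms_mul_mem φ.2 ψ.2⟩ := by
  rw [DirectSum.of_mul_of]
  rfl

end Ring

/-! ### The functor `Φ^*` and unit modules -/

section Unit

variable (p a b : ℕ) (R : Type u) [CommRing R] (M : Type v) [AddCommGroup M]
  [Module (DPhi p a b R) M]

/-- The subgroup of `Hom_R(F^{(0)}_* R, F^{(1)}_* R) ⊗_ℤ M` generated by the elements
`φ d ⊗ m - φ ⊗ d m` with `d ∈ D^{(0)}`. -/
def balancedRelations : AddSubgroup (frobHoms p a b R 1 ⊗[ℤ] M) :=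
  AddSubgroup.closure
    {t | ∃ (φ : frobHoms p a b R 1) (d : frobHoms p a b R 0) (m : M),
      t = (⟨φ.1 * d.1, frobHoms_mul_mem φ.2 d.2⟩ : frobHoms p a b R 1) ⊗ₜ[ℤ] m -
        φ ⊗ₜ[ℤ] ((DirectSum.of (fun i => frobHoms p a b R i) 0 d : DPhi p a b R) • m)}

/-- `Φ^*(M) = Hom_R(F^{(0)}_* R, F^{(1)}_* R) ⊗_{D^{(0)}} M`, the tensor product over the
noncommutative ring `D^{(0)}`. -/
abbrev PhiPullback : Type (max u v) := (frobHoms p a b R 1 ⊗[ℤ] M) ⧸ balancedRelations p a b R M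

/-- The biadditive action map `(φ, m) ↦ φ m` on `Hom_R(F^{(0)}_* R, F^{(1)}_* R) ⊗_ℤ M`. -/
def preStructureMap : frobHoms p a b R 1 ⊗[ℤ] M →+ M :=
  TensorProduct.liftAddHom
    ((smulAddHom (DPhi p a b R) M).comp (DirectSum.of (fun i => frobHoms p a b R i) 1))
    (fun r φ m => by
      simp only [AddMonoidHom.comp_apply, map_zsmul, AddMonoidHom.zsmul_apply])

/-- The natural map `ψ_M : Φ^*(M) → M`, `φ ⊗ m ↦ φ m`. -/
def structureMap : PhiPullback p a b R M →+ M :=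
  QuotientAddGroup.lift (balancedRelations p a b R M) (preStructureMap p a b R M) (by
    rw [balancedRelations, AddSubgroup.closure_le]
    rintro _ ⟨φ, d, m, rfl⟩
    change preStructureMap p a b R M _ = 0
    rw [map_sub, sub_eq_zero]
    change (DirectSum.of (fun i => frobHoms p a b R i) 1 _ : DPhi p a b R) • m =
      (DirectSum.of (fun i => frobHoms p a b R i) 1 φ : DPhi p a b R) •
        (DirectSum.of (fun i => frobHoms p a b R i) 0 d : DPhi p a b R) • m
    rw [smul_smul, DPhi.of_mul_of])

theorem structureMap_tmul (φ : frobHoms p a b R 1) (m : M) :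
    structureMap p a b R M (QuotientAddGroup.mk (φ ⊗ₜ[ℤ] m)) =
      (DirectSum.of (fun i => frobHoms p a b R i) 1 φ : DPhi p a b R) • m := rfl

/-- A left `D^{(0)}⟨Φ⟩`-module `M` is unit if `ψ_M` is an isomorphism; as `ψ_M` is
`D^{(0)}`-linear, this means that it is bijective. -/
def IsUnitModule : Prop := Function.Bijective (structureMap p a b R M)

/-- The finitely generated unit modules, as a property of left `D^{(0)}⟨Φ⟩`-modules. The
associated full subcategory is `(fguModules p a b R).FullSubcategory`. -/
def fguModules : ObjectProperty (ModuleCat.{v} (DPhi p a b R)) := fun M =>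
  Module.Finite (DPhi p a b R) M ∧ IsUnitModule p a b R M

end Unit

end PhiMod

end

/-!
Everything rests on one consequence of finite `F`-representation type: there are homomorphisms
`φ k : F^a_* R → F^{a+b}_* R` and `θ k : F^{a+b}_* R → F^a_* R` with `∑ φ k θ k = 1`
(`FrobDualBasis`, `nonempty_frobDualBasis`). Over the completion `B` of a local ring of `R`, the
module `F^{a+b}_* B` is a finite direct sum of indecomposables, all of which are summands of
`F^a_* B` by hypothesis, so its identity is a sum of endomorphisms that factor through `F^a_* B`. As
`B` is flat over `R` and `F^e_* B = B ⊗ F^e_* R`, homomorphisms between these modules are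
`B`-combinations of homomorphisms over `R`. Hence the ideal of those `r` for which `r • id` is a sum
of endomorphisms of `F^{a+b}_* R` factoring through `F^a_* R` lies in no prime ideal.

The pairs `(φ k, θ k)` form a dual basis of the right `D^{(0)}`-module
`Hom_R(F^a_* R, F^{a+b}_* R)`, so the functor `Φ^*` is exact. In elementary terms, a module `M` is
unit if and only if its elements have the form `∑ φ k m k` and every relation `∑ φ j m j = 0`
implies `∑ j, (θ k φ j) m j = 0` for all `k` (`isUnitModule_iff`). Moreover the homomorphisms `θ k`,
of degree `-1`, act on every unit module through operators `T k` with `∑ φ k T k = 1`, and these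
commute with all homomorphisms of unit modules (`DualAction`). Unit modules are therefore closed
under kernels, cokernels and extensions.

For finite generation, `M` is viewed as an `R`-module through the multiplications in `D^{(0)}`, over
which each `Hom_R(F^a_* R, F^{a+ib}_* R)` is finitely generated. If `M` is a finitely generated unit
module, then the elements `φ g`, with `g` in a finite generating set and `φ` homogeneous of bounded
degree, generate a finitely generated `R`-submodule `N` that is stable under `D^{(0)}` and, once the
bound is large, under the `T k`. Long enough compositions of the `T k` carry any given element
of `M` into `N`. Since `∑ φ k T k = 1` and the `T k` preserve unit submodules, every unit
submodule `L` of `M` is generated by `N ∩ L` (`exists_fg_forall_span_inter_eq`). As `R` is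
noetherian, `L` is finitely generated, and ascending chains of such `L` stabilize.
-/

noncomputable section

namespace PhiMod

/-! ### Decompositions over local rings -/

/-- Over a local ring, a finitely generated module is a finite direct sum of indecomposables: the
dimension of the special fibre bounds the number of nonzero summands. -/
theorem exists_linearEquiv_pi_indecomposable (B : Type u) [CommRing B] [IsLocalRing B]
    (N : Type u) [AddCommGroup N] [Module B N] [Module.Finite B N] :
    ∃ (ι : Type) (_ : Fintype ι) (X : ι → ModuleCat.{u} B),
      (∀ i, Module.Finite B (X i) ∧ IsIndecomposableModule B (X i)) ∧
      Nonempty (N ≃ₗ[B] ((i : ι) → X i)) := by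
  let k := IsLocalRing.ResidueField B
  suffices H : ∀ (d : ℕ) (N : Type u) [AddCommGroup N] [Module B N] [Module.Finite B N],
      Module.finrank k (k ⊗[B] N) = d →
      ∃ (ι : Type) (_ : Fintype ι) (X : ι → ModuleCat.{u} B),
        (∀ i, Module.Finite B (X i) ∧ IsIndecomposableModule B (X i)) ∧
        Nonempty (N ≃ₗ[B] ((i : ι) → X i)) from H _ N rfl
  intro d
  induction d using Nat.strong_induction_on with
  | _ d ih =>
  intro N _ _ _ hd
  by_cases hN : Nontrivial N
  swap
  · rw [not_nontrivial_iff_subsingleton] at hN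
    exact ⟨Empty, inferInstance, fun i => i.elim, fun i => i.elim,
      ⟨LinearEquiv.ofSubsingleton _ _⟩⟩
  by_cases hI : IsIndecomposableModule B N
  · exact ⟨Unit, inferInstance, fun _ => ModuleCat.of B N, fun _ => ⟨‹_›, hI⟩,
      ⟨(LinearEquiv.funUnique Unit B N).symm⟩⟩
  have hI' : ∃ A C : Submodule B N, IsCompl A C ∧ A ≠ ⊥ ∧ C ≠ ⊥ := by
    by_contra hcon
    push Not at hcon
    refine hI ⟨hN, fun A C hAC => ?_⟩
    by_cases hA : A = ⊥
    · exact Or.inl hA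
    · exact Or.inr (hcon A C hAC hA)
  obtain ⟨A, C, hAC, hA, hC⟩ := hI'
  let e : (A × C) ≃ₗ[B] N := Submodule.prodEquivOfIsCompl A C hAC
  have fA : Module.Finite B A :=
    Module.Finite.of_surjective ((LinearMap.fst B A C) ∘ₗ e.symm.toLinearMap)
      (fun x => ⟨e (x, 0), by simp⟩)
  have fC : Module.Finite B C :=
    Module.Finite.of_surjective ((LinearMap.snd B A C) ∘ₗ e.symm.toLinearMap)
      (fun x => ⟨e (0, x), by simp⟩)
  have hsum : Module.finrank k (k ⊗[B] A) + Module.finrank k (k ⊗[B] C) = d := by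
    rw [← hd, ← Module.finrank_prod]
    exact LinearEquiv.finrank_eq
      ((TensorProduct.prodRight B k k A C).symm ≪≫ₗ e.baseChange B k _ _)
  have pos : ∀ (X : Submodule B N) [Module.Finite B X], X ≠ ⊥ →
      0 < Module.finrank k (k ⊗[B] X) := by
    intro X _ hX
    have : Nontrivial X := (Submodule.nontrivial_iff_ne_bot).mpr hX
    have : Nontrivial (k ⊗[B] X) := by
      rw [← not_subsingleton_iff_nontrivial, IsLocalRing.subsingleton_tensorProduct,
        not_subsingleton_iff_nontrivial]
      exact this
    exact Module.finrank_pos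
  have pA := pos A hA
  have pC := pos C hC
  obtain ⟨ι, _, X, hX, ⟨eX⟩⟩ := ih _ (by omega) A rfl
  obtain ⟨κ, _, Y, hY, ⟨eY⟩⟩ := ih _ (by omega) C rfl
  let Z : ι ⊕ κ → ModuleCat.{u} B := Sum.elim X Y
  refine ⟨ι ⊕ κ, inferInstance, Z, ?_, ⟨?_⟩⟩
  · rintro (i | i)
    · exact hX i
    · exact hY i
  · exact e.symm ≪≫ₗ (LinearEquiv.prodCongr eX eY) ≪≫ₗ
      (LinearEquiv.sumPiEquivProdPi B ι κ (fun i => (Z i : Type u))).symm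

/-- If every indecomposable component of `N` occurs in `M`, then `N` is a direct summand of a
finite direct sum of copies of `M`. -/
theorem exists_sum_comp_eq_id_of_indecComponents_subset (B : Type u) [CommRing B] [IsLocalRing B]
    (M N : Type u) [AddCommGroup M] [Module B M] [AddCommGroup N] [Module B N] [Module.Finite B N]
    (h : indecComponents B N ⊆ indecComponents B M) :
    ∃ (ι : Type) (_ : Fintype ι) (φ : ι → M →ₗ[B] N) (θ : ι → N →ₗ[B] M),
      ∑ k, φ k ∘ₗ θ k = LinearMap.id := by
  classical
  obtain ⟨ι, _, X, hX, ⟨e⟩⟩ := exists_linearEquiv_pi_indecomposable B N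
  -- each summand of `N` is a retract of `M`
  have key : ∀ i, ∃ (f : X i →ₗ[B] M) (g : M →ₗ[B] X i), g ∘ₗ f = LinearMap.id := by
    intro i
    have hi : Quotient.mk (isIsomorphicSetoid (ModuleCat.{u} B)) (X i) ∈ indecComponents B N := by
      let σ := Fintype.equivFin ι
      refine ⟨Fintype.card ι, fun j => X (σ.symm j), fun j => hX _,
        ⟨e ≪≫ₗ (LinearEquiv.piCongrLeft B (fun i => (X i : Type u)) σ.symm).symm⟩, σ i, ?_⟩
      simp
    obtain ⟨n, Y, -, ⟨eM⟩, j, hj⟩ := h hi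
    obtain ⟨iso⟩ := Quotient.exact hj
    let ε : X i ≃ₗ[B] Y j := iso.toLinearEquiv
    refine ⟨eM.symm.toLinearMap ∘ₗ LinearMap.single B (fun j => (Y j : Type u)) j ∘ₗ
      ε.toLinearMap, ε.symm.toLinearMap ∘ₗ LinearMap.proj j ∘ₗ eM.toLinearMap, ?_⟩
    ext x
    simp
  choose f g hfg using key
  refine ⟨ι, inferInstance,
    fun i => e.symm.toLinearMap ∘ₗ LinearMap.single B (fun j => (X j : Type u)) i ∘ₗ g i,
    fun i => f i ∘ₗ LinearMap.proj i ∘ₗ e.toLinearMap, ?_⟩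
  ext x
  have hgf : ∀ i (y : X i), g i (f i y) = y := fun i y => LinearMap.congr_fun (hfg i) y
  simp only [LinearMap.coe_sum, Finset.sum_apply, LinearMap.comp_apply, LinearEquiv.coe_coe,
    LinearMap.proj_apply, LinearMap.id_apply, hgf]
  rw [← map_sum, LinearEquiv.symm_apply_eq]
  exact LinearMap.sum_single_apply (fun j => (X j : Type u)) (e x)

/-! ### Descent of a direct-summand relation along flat algebras -/

/-- The `R`-span of the endomorphisms of `N` that factor through `M`. -/
def factorSpan (R : Type*) [CommRing R] (M N : Type*) [AddCommGroup M] [Module R M]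
    [AddCommGroup N] [Module R N] : Submodule R (N →ₗ[R] N) :=
  Submodule.span R {f | ∃ (φ : M →ₗ[R] N) (θ : N →ₗ[R] M), f = φ ∘ₗ θ}

/-- Homomorphisms between base changes along a flat algebra are spanned by base changes of
homomorphisms. -/
theorem mem_span_range_baseChange (R : Type*) [CommRing R] (B : Type*) [CommRing B] [Algebra R B]
    [Module.Flat R B] (M N : Type*) [AddCommGroup M] [Module R M] [AddCommGroup N] [Module R N]
    [Module.FinitePresentation R M] (f : B ⊗[R] M →ₗ[B] B ⊗[R] N) :
    f ∈ Submodule.span B (Set.range (fun g : M →ₗ[R] N => g.baseChange B)) := by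
  have h := Module.FinitePresentation.isBaseChange_map R M N B
  obtain ⟨t, rfl⟩ := h.equiv.surjective f
  induction t with
  | zero => simp
  | add x y hx hy => rw [map_add]; exact add_mem hx hy
  | tmul b g =>
    rw [h.equiv_tmul]
    exact Submodule.smul_mem _ _ (Submodule.subset_span ⟨g, rfl⟩)

/-- If the identity of `B ⊗ N` is a sum of endomorphisms that factor through `B ⊗ M`, with `B`
flat, then the ideal of those `r` for which `r • id_N` is a sum of endomorphisms factoring through
`M` extends to the unit ideal of `B`. -/
theorem map_colon_factorSpan_eq_top (R : Type*) [CommRing R] (B : Type*) [CommRing B]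
    [Algebra R B] [Module.Flat R B] (M N : Type*) [AddCommGroup M] [Module R M] [AddCommGroup N]
    [Module R N] [Module.FinitePresentation R M] [Module.FinitePresentation R N]
    (h : LinearMap.id ∈ factorSpan B (B ⊗[R] M) (B ⊗[R] N)) :
    Ideal.map (algebraMap R B) (Submodule.comap
      (LinearMap.toSpanSingleton R (N →ₗ[R] N) LinearMap.id) (factorSpan R M N)) = ⊤ := by
  set I := factorSpan R M N with hI
  set J : Ideal R := Submodule.comap (LinearMap.toSpanSingleton R (N →ₗ[R] N) LinearMap.id) I
    with hJ
  have h1 : (LinearMap.id : B ⊗[R] N →ₗ[B] B ⊗[R] N) ∈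
      Submodule.span B ((fun g : N →ₗ[R] N => g.baseChange B) '' I) := by
    refine (Submodule.span_le.mpr ?_ : factorSpan B (B ⊗[R] M) (B ⊗[R] N) ≤ _) h
    rintro _ ⟨φ, θ, rfl⟩
    have hφ := mem_span_range_baseChange R B M N φ
    have hθ := mem_span_range_baseChange R B N M θ
    change φ ∘ₗ θ ∈ _
    induction hφ using Submodule.span_induction with
    | zero => simp
    | add x y _ _ hx hy => rw [LinearMap.add_comp]; exact add_mem hx hy
    | smul b x _ hx => rw [LinearMap.smul_comp]; exact Submodule.smul_mem _ _ hx
    | mem x hx =>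
      obtain ⟨φ', rfl⟩ := hx
      induction hθ using Submodule.span_induction with
      | zero => simp
      | add x y _ _ hx hy => rw [LinearMap.comp_add]; exact add_mem hx hy
      | smul b x _ hx => rw [LinearMap.comp_smul]; exact Submodule.smul_mem _ _ hx
      | mem x hx =>
        obtain ⟨θ', rfl⟩ := hx
        refine Submodule.subset_span ⟨φ' ∘ₗ θ', Submodule.subset_span ⟨φ', θ', rfl⟩, ?_⟩
        exact LinearMap.baseChange_comp _ _
  -- hence `1 ⊗ id` dies in `B ⊗ (End N / I)`
  have hbc := Module.FinitePresentation.isBaseChange_map R N N B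
  have h2 : ∀ f ∈ Submodule.span B ((fun g : N →ₗ[R] N => g.baseChange B) '' I),
      I.mkQ.baseChange B (hbc.equiv.symm f) = 0 := by
    intro f hf
    induction hf using Submodule.span_induction with
    | zero => simp
    | add x y _ _ hx hy => rw [map_add, map_add, hx, hy, add_zero]
    | smul b x _ hx => rw [map_smul, map_smul, hx, smul_zero]
    | mem x hx =>
      obtain ⟨g, hg, rfl⟩ := hx
      have : hbc.equiv.symm (g.baseChange B) = 1 ⊗ₜ g := by
        rw [LinearEquiv.symm_apply_eq, hbc.equiv_tmul, one_smul]
        rfl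
      change I.mkQ.baseChange B (hbc.equiv.symm (g.baseChange B)) = 0
      have h0 : I.mkQ g = 0 := (Submodule.Quotient.mk_eq_zero I).mpr hg
      rw [this, LinearMap.baseChange_tmul, h0, TensorProduct.tmul_zero]
  have h3 : (1 : B) ⊗ₜ[R] (I.mkQ LinearMap.id) = 0 := by
    have := h2 _ h1
    have h4 : hbc.equiv.symm (LinearMap.id : B ⊗[R] N →ₗ[B] B ⊗[R] N) =
        1 ⊗ₜ (LinearMap.id : N →ₗ[R] N) := by
      rw [LinearEquiv.symm_apply_eq, hbc.equiv_tmul, one_smul]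
      exact (LinearMap.baseChange_id).symm
    rwa [h4, LinearMap.baseChange_tmul] at this
  -- by flatness `B ⊗ R/J` embeds into `B ⊗ (End N / I)`
  let j : (R ⧸ J) →ₗ[R] ((N →ₗ[R] N) ⧸ I) :=
    Submodule.mapQ J I (LinearMap.toSpanSingleton R (N →ₗ[R] N) LinearMap.id) le_rfl
  have hj : Function.Injective j := by
    rw [← LinearMap.ker_eq_bot, Submodule.ker_mapQ, ← hJ, Submodule.mkQ_map_self]
  have hj' : Function.Injective (j.lTensor B) :=
    Module.Flat.lTensor_preserves_injective_linearMap j hj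
  have h5 : (1 : B) ⊗ₜ[R] (1 : R ⧸ J) = 0 := by
    apply hj'
    rw [map_zero, LinearMap.lTensor_tmul, ← h3]
    congr 1
    change j (Submodule.Quotient.mk 1) = _
    rw [Submodule.mapQ_apply]
    simp
  rw [Ideal.eq_top_iff_one, ← Ideal.Quotient.eq_zero_iff_mem]
  have h6 := congrArg (Algebra.TensorProduct.lift
    (Ideal.Quotient.mkₐ B (J.map (algebraMap R B)))
    (Ideal.quotientMapₐ (I := J) (J.map (algebraMap R B)) (Algebra.ofId R B)
      (by exact Ideal.le_comap_map)) (fun _ _ => Commute.all _ _)) h5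
  simpa using h6

/-! ### Base change of Frobenius push-forwards -/

theorem finite_frobPush (p : ℕ) (R : Type*) [CommRing R] [ExpChar R p]
    (h : Module.Finite R (FrobPush p 1 R R)) (e : ℕ) : Module.Finite R (FrobPush p e R R) := by
  have h1 : (iterateFrobenius R p 1).Finite := h
  suffices H : (iterateFrobenius R p e).Finite from H
  induction e with
  | zero =>
    have : iterateFrobenius R p 0 = RingHom.id R := by ext x; simp
    rw [this]
    exact RingHom.Finite.id R
  | succ e ih =>
    have : iterateFrobenius R p (e + 1) =
        (iterateFrobenius R p e).comp (iterateFrobenius R p 1) := by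
      ext x
      simp [iterateFrobenius_def, frobenius_def, ← pow_mul, pow_succ, mul_comm]
    rw [this]
    exact ih.comp h1

/-- Frobenius push-forward commutes with localization. -/
theorem nonempty_localization_tensor_frobPush (p e : ℕ) (R S : Type*) [CommRing R] [CommRing S]
    [ExpChar R p] [ExpChar S p] [Algebra R S] (W : Submonoid R) [IsLocalization W S] :
    Nonempty (S ⊗[R] FrobPush p e R R ≃ₗ[S] FrobPush p e S S) := by
  have hp : 0 < p ^ e := pow_pos (expChar_pos R p) e
  let _ : Module R (FrobPush p e S S) := Module.compHom _ (algebraMap R S)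
  have smul_def : ∀ (r : R) (x : S), r • toFrobPush p e S S x =
      toFrobPush p e S S (algebraMap R S r ^ p ^ e * x) := fun _ _ => rfl
  have : IsScalarTower R S (FrobPush p e S S) := ⟨fun r s x => by
    rw [Algebra.smul_def, mul_smul]; rfl⟩
  let f : FrobPush p e R R →ₗ[R] FrobPush p e S S :=
    { toFun := fun u => toFrobPush p e S S (algebraMap R S ((toFrobPush p e R R).symm u))
      map_add' := fun u w => by simp
      map_smul' := fun r u => by
        rw [RingHom.id_apply, smul_def, ← map_pow, ← map_mul]; rfl }
  have f_apply : ∀ u : R, f (toFrobPush p e R R u) = toFrobPush p e S S (algebraMap R S u) :=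
    fun _ => rfl
  have hunit : ∀ w : W, IsUnit (algebraMap R S w) := IsLocalization.map_units S
  have : IsLocalizedModule W f := by
    refine ⟨fun w => ?_, fun y => ?_, fun {x₁ x₂} h => ?_⟩
    · obtain ⟨c, hc⟩ := (hunit w).pow (p ^ e)
      rw [Module.End.isUnit_iff]
      constructor
      · intro x y hxy
        obtain ⟨x, rfl⟩ := (toFrobPush p e S S).surjective x
        obtain ⟨y, rfl⟩ := (toFrobPush p e S S).surjective y
        change (w : R) • toFrobPush p e S S x = (w : R) • toFrobPush p e S S y at hxy
        rw [smul_def, smul_def, ← hc] at hxy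
        rw [c.isUnit.mul_left_cancel ((toFrobPush p e S S).injective hxy)]
      · intro y
        obtain ⟨y, rfl⟩ := (toFrobPush p e S S).surjective y
        refine ⟨toFrobPush p e S S (c⁻¹.1 * y), ?_⟩
        change (w : R) • toFrobPush p e S S _ = _
        rw [smul_def, ← hc, ← mul_assoc, c.mul_inv, one_mul]
    · obtain ⟨y, rfl⟩ := (toFrobPush p e S S).surjective y
      obtain ⟨⟨r, w⟩, hrw⟩ := IsLocalization.surj W y
      refine ⟨⟨toFrobPush p e R R (r * (w : R) ^ (p ^ e - 1)), w⟩, ?_⟩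
      change (w : R) • toFrobPush p e S S y = _
      rw [smul_def, f_apply, map_mul (algebraMap R S), ← hrw, map_pow, mul_assoc, ← pow_succ',
        Nat.sub_add_cancel hp, mul_comm]
    · obtain ⟨x₁, rfl⟩ := (toFrobPush p e R R).surjective x₁
      obtain ⟨x₂, rfl⟩ := (toFrobPush p e R R).surjective x₂
      rw [f_apply, f_apply] at h
      obtain ⟨c, hc⟩ := IsLocalization.exists_of_eq (M := W) ((toFrobPush p e S S).injective h)
      refine ⟨c, ?_⟩
      rw [Submonoid.smul_def, Submonoid.smul_def, smul_toFrobPush, smul_toFrobPush, smul_eq_mul,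
        smul_eq_mul, ← Nat.sub_add_cancel hp, pow_succ, mul_assoc, mul_assoc, hc]
  exact ⟨((isLocalizedModule_iff_isBaseChange W S f).mp this).equiv⟩

section Completion

variable (p e : ℕ) {S : Type u} [CommRing S] [ExpChar S p] (m : Ideal S)

/-- The map `F^e_* S / m^n F^e_* S → F^e_* (S / m^n)`. -/
def frobPushQuotientMap (n : ℕ) :
    (FrobPush p e S S ⧸ (m ^ n • ⊤ : Submodule S (FrobPush p e S S))) →ₗ[S]
      FrobPush p e S (S ⧸ (m ^ n • ⊤ : Submodule S S)) :=
  Submodule.liftQ _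
    ({ toFun := fun u => toFrobPush p e S _ (Submodule.Quotient.mk ((toFrobPush p e S S).symm u))
       map_add' := fun _ _ => rfl
       map_smul' := fun _ _ => rfl } :
      FrobPush p e S S →ₗ[S] FrobPush p e S (S ⧸ (m ^ n • ⊤ : Submodule S S)))
    (by
      rw [Submodule.smul_le]
      intro r hr u _
      obtain ⟨u, rfl⟩ := (toFrobPush p e S S).surjective u
      rw [smul_toFrobPush, LinearMap.mem_ker]
      change toFrobPush p e S _ (Submodule.Quotient.mk (r ^ p ^ e • u)) = 0
      rw [(Submodule.Quotient.mk_eq_zero _).mpr, map_zero]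
      have : r ^ p ^ e ∈ m ^ n :=
        Ideal.pow_mem_of_mem _ hr _ (pow_pos (expChar_pos S p) e)
      simpa using Ideal.mul_mem_right u _ this)

/-- The topology on `F^e_* S` defined by its submodules `m^n F^e_* S` is the `m`-adic topology of
the ring `S`, since `m^n` lies in the radical of the ideal generated by its `p^e`-th powers. -/
theorem exists_pow_subset_smul_top_frobPush [IsNoetherianRing S] (n : ℕ) :
    ∃ k, n ≤ k ∧ ∀ u ∈ m ^ k,
      toFrobPush p e S S u ∈ (m ^ n • ⊤ : Submodule S (FrobPush p e S S)) := by
  set J : Ideal S := (m ^ n).map (iterateFrobenius S p e) with hJ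
  have hrad : m ^ n ≤ J.radical := fun x hx =>
    ⟨p ^ e, by rw [← iterateFrobenius_def]; exact Ideal.mem_map_of_mem _ hx⟩
  obtain ⟨k, hk⟩ := Ideal.exists_pow_le_of_le_radical_of_fg_radical hrad
    (IsNoetherian.noetherian _)
  refine ⟨n * (k + 1), Nat.le_mul_of_pos_right _ k.succ_pos, fun u hu => ?_⟩
  have hu' : u ∈ J := by
    rw [pow_mul] at hu
    exact hk (Ideal.pow_le_pow_right k.le_succ hu)
  rw [hJ, Ideal.map] at hu'
  clear hu
  induction hu' using Submodule.span_induction with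
  | mem x hx =>
    obtain ⟨y, hy, rfl⟩ := hx
    have := Submodule.smul_mem_smul (N := (⊤ : Submodule S (FrobPush p e S S))) hy
      (Submodule.mem_top (x := toFrobPush p e S S 1))
    rwa [smul_toFrobPush, smul_eq_mul, mul_one, ← iterateFrobenius_def] at this
  | zero => rw [map_zero]; exact zero_mem _
  | add x y _ _ hx hy => rw [map_add]; exact add_mem hx hy
  | smul c x _ hx =>
    let L : FrobPush p e S S →ₗ[S] FrobPush p e S S :=
      { toFun := fun u => toFrobPush p e S S (c * (toFrobPush p e S S).symm u)
        map_add' := fun u w => by simp [mul_add]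
        map_smul' := fun r u => congrArg (toFrobPush p e S S) (mul_left_comm _ _ _) }
    exact Submodule.smul_top_le_comap_smul_top _ L hx

/-- The element of the completion of `S` with the same components, modulo the powers of `m`, as a
given element of the completion of `F^e_* S`. -/
def frobPushCompletionFun (x : AdicCompletion m (FrobPush p e S S)) : AdicCompletion m S :=
  ⟨fun n => (toFrobPush p e S _).symm (frobPushQuotientMap p e m n (x.val n)), fun {k l} hkl => by
    have compat : ∀ z, AdicCompletion.transitionMap m S hkl
        ((toFrobPush p e S _).symm (frobPushQuotientMap p e m l z)) =
        (toFrobPush p e S _).symm (frobPushQuotientMap p e m k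
          (AdicCompletion.transitionMap m (FrobPush p e S S) hkl z)) := by
      intro z
      obtain ⟨u, rfl⟩ := Submodule.Quotient.mk_surjective _ z
      rfl
    exact (compat _).trans (congrArg (fun z => (toFrobPush p e S _).symm
      (frobPushQuotientMap p e m k z)) (x.property hkl))⟩

theorem frobPushCompletionFun_val (x : AdicCompletion m (FrobPush p e S S)) (n : ℕ) :
    (frobPushCompletionFun p e m x).val n =
      (toFrobPush p e S _).symm (frobPushQuotientMap p e m n (x.val n)) := rfl

theorem frobPushCompletionFun_add (x y : AdicCompletion m (FrobPush p e S S)) :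
    frobPushCompletionFun p e m (x + y) =
      frobPushCompletionFun p e m x + frobPushCompletionFun p e m y := by
  apply AdicCompletion.ext
  intro n
  exact (congrArg (toFrobPush p e S _).symm (map_add (frobPushQuotientMap p e m n) _ _)).trans
    (map_add _ _ _)

theorem frobPushCompletionFun_smul (s : AdicCompletion m S)
    (x : AdicCompletion m (FrobPush p e S S)) :
    frobPushCompletionFun p e m (s • x) = s ^ p ^ e * frobPushCompletionFun p e m x := by
  apply AdicCompletion.ext
  intro n
  obtain ⟨u, hu⟩ := Submodule.Quotient.mk_surjective _ (x.val n)
  obtain ⟨r, hr⟩ := Submodule.Quotient.mk_surjective _ (s.val n)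
  change (toFrobPush p e S _).symm (frobPushQuotientMap p e m n (s.val n • x.val n)) =
    s.val n ^ p ^ e * (toFrobPush p e S _).symm (frobPushQuotientMap p e m n (x.val n))
  rw [← hu, ← hr]
  rfl

/-- The natural map from the `m`-adic completion of the `S`-module `F^e_* S` to `F^e_*` of the
completion of `S`. -/
def frobPushCompletionMap [ExpChar (AdicCompletion m S) p] :
    AdicCompletion m (FrobPush p e S S) →ₗ[AdicCompletion m S]
      FrobPush p e (AdicCompletion m S) (AdicCompletion m S) where
  toFun x := toFrobPush p e _ _ (frobPushCompletionFun p e m x)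
  map_add' x y := by rw [frobPushCompletionFun_add, map_add]
  map_smul' s x := by
    rw [frobPushCompletionFun_smul, RingHom.id_apply, smul_toFrobPush, smul_eq_mul]

theorem frobPushCompletionMap_bijective [IsNoetherianRing S] [ExpChar (AdicCompletion m S) p] :
    Function.Bijective (frobPushCompletionMap p e m) := by
  choose K hK hKm using exists_pow_subset_smul_top_frobPush p e m
  have val_eq : ∀ (x : AdicCompletion m (FrobPush p e S S)) (n : ℕ),
      ((toFrobPush p e _ _).symm (frobPushCompletionMap p e m x)).val n =
        (toFrobPush p e S _).symm (frobPushQuotientMap p e m n (x.val n)) :=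
    frobPushCompletionFun_val p e m
  constructor
  · rw [← LinearMap.ker_eq_bot, LinearMap.ker_eq_bot']
    intro x hx
    apply AdicCompletion.ext
    intro n
    obtain ⟨u, hu⟩ := Submodule.Quotient.mk_surjective _ (x.val (K n))
    obtain ⟨u, rfl⟩ := (toFrobPush p e S S).surjective u
    have h1 := val_eq x (K n)
    rw [hx, ← hu] at h1
    have h2 : (Submodule.Quotient.mk u : S ⧸ (m ^ K n • ⊤ : Submodule S S)) = 0 := h1.symm
    rw [Submodule.Quotient.mk_eq_zero, smul_eq_mul, Ideal.mul_top] at h2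
    rw [← x.property (hK n), ← hu]
    exact (Submodule.Quotient.mk_eq_zero _).mpr (hKm n u h2)
  · intro y
    obtain ⟨y, rfl⟩ := (toFrobPush p e _ _).surjective y
    obtain ⟨f, rfl⟩ := AdicCompletion.mk_surjective m S y
    refine ⟨⟨fun n => Submodule.Quotient.mk (toFrobPush p e S S (f (K n))), ?_⟩, ?_⟩
    · intro k l hkl
      change (Submodule.Quotient.mk (toFrobPush p e S S (f (K l))) :
        FrobPush p e S S ⧸ (m ^ k • ⊤ : Submodule S (FrobPush p e S S))) =
          Submodule.Quotient.mk (toFrobPush p e S S (f (K k)))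
      rw [Submodule.Quotient.eq, ← map_sub]
      rcases le_total (K k) (K l) with h | h
      · have := AdicCompletion.AdicCauchySequence.mk_eq_mk h f
        rw [Submodule.Quotient.eq, smul_eq_mul, Ideal.mul_top] at this
        exact hKm k _ this
      · have := AdicCompletion.AdicCauchySequence.mk_eq_mk h f
        rw [eq_comm, Submodule.Quotient.eq, smul_eq_mul, Ideal.mul_top] at this
        exact Submodule.smul_mono_left (Ideal.pow_le_pow_right hkl) (hKm l _ this)
    · apply (toFrobPush p e _ _).symm.injective
      apply AdicCompletion.ext
      intro n
      exact AdicCompletion.AdicCauchySequence.mk_eq_mk (hK n) f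

/-- Frobenius push-forward commutes with completion of `F`-finite noetherian rings. -/
theorem nonempty_completion_tensor_frobPush [IsNoetherianRing S] [ExpChar (AdicCompletion m S) p]
    [Module.Finite S (FrobPush p e S S)] :
    Nonempty (AdicCompletion m S ⊗[S] FrobPush p e S S ≃ₗ[AdicCompletion m S]
      FrobPush p e (AdicCompletion m S) (AdicCompletion m S)) :=
  ⟨AdicCompletion.ofTensorProductEquivOfFiniteNoetherian m (FrobPush p e S S) ≪≫ₗ
    LinearEquiv.ofBijective _ (frobPushCompletionMap_bijective p e m)⟩

end Completion

theorem nonempty_completedLocalization_tensor_frobPush (p : ℕ) [Fact p.Prime] {R : Type u}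
    [CommRing R] [CharP R p] [IsNoetherianRing R] (e : ℕ) [Module.Finite R (FrobPush p e R R)]
    (P : Ideal R) [P.IsPrime] :
    Nonempty (CompletedLocalization P ⊗[R] FrobPush p e R R ≃ₗ[CompletedLocalization P]
      FrobPush p e (CompletedLocalization P) (CompletedLocalization P)) := by
  have h0 : (p : Localization.AtPrime P) = 0 := by
    rw [← map_natCast (algebraMap R (Localization.AtPrime P)), CharP.cast_eq_zero, map_zero]
  have : CharP (Localization.AtPrime P) p := 
    ringChar.of_eq (CharP.ringChar_of_prime_eq_zero Fact.out h0)
  have : IsNoetherianRing (Localization.AtPrime P) :=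
    IsLocalization.isNoetherianRing P.primeCompl _ ‹_›
  obtain ⟨e₁⟩ := nonempty_localization_tensor_frobPush p e R (Localization.AtPrime P) P.primeCompl
  have : Module.Finite (Localization.AtPrime P)
      (FrobPush p e (Localization.AtPrime P) (Localization.AtPrime P)) := Module.Finite.equiv e₁
  obtain ⟨e₂⟩ := nonempty_completion_tensor_frobPush p e
    (IsLocalRing.maximalIdeal (Localization.AtPrime P))
  exact ⟨(TensorProduct.AlgebraTensorModule.cancelBaseChange R (Localization.AtPrime P)
    (CompletedLocalization P) (CompletedLocalization P) (FrobPush p e R R)).symm ≪≫ₗ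
    TensorProduct.AlgebraTensorModule.congr (LinearEquiv.refl _ _) e₁ ≪≫ₗ e₂⟩

/-! ### A dual basis for homomorphisms between Frobenius push-forwards -/

theorem exists_sum_comp_of_mem_factorSpan {R : Type*} [CommRing R] {M N : Type*} [AddCommGroup M]
    [Module R M] [AddCommGroup N] [Module R N] {f : N →ₗ[R] N} (hf : f ∈ factorSpan R M N) :
    ∃ (ι : Type) (_ : Fintype ι) (φ : ι → M →ₗ[R] N) (θ : ι → N →ₗ[R] M),
      ∑ k, φ k ∘ₗ θ k = f := by
  induction hf using Submodule.span_induction with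
  | mem x hx =>
    obtain ⟨φ, θ, rfl⟩ := hx
    exact ⟨Unit, inferInstance, fun _ => φ, fun _ => θ, by simp⟩
  | zero => exact ⟨Empty, inferInstance, fun i => i.elim, fun i => i.elim, by simp⟩
  | add x y _ _ hx hy =>
    obtain ⟨ι, _, φ, θ, rfl⟩ := hx
    obtain ⟨κ, _, φ', θ', rfl⟩ := hy
    exact ⟨ι ⊕ κ, inferInstance, Sum.elim φ φ', Sum.elim θ θ', by simp⟩
  | smul r x _ hx =>
    obtain ⟨ι, _, φ, θ, rfl⟩ := hx
    exact ⟨ι, inferInstance, fun k => r • φ k, θ, by simp [LinearMap.smul_comp, Finset.smul_sum]⟩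

theorem id_mem_factorSpan_of_equiv {B : Type*} [CommRing B] {M N M' N' : Type*} [AddCommGroup M]
    [Module B M] [AddCommGroup N] [Module B N] [AddCommGroup M'] [Module B M'] [AddCommGroup N']
    [Module B N'] (eM : M' ≃ₗ[B] M) (eN : N' ≃ₗ[B] N) {ι : Type*} [Fintype ι]
    (φ : ι → M →ₗ[B] N) (θ : ι → N →ₗ[B] M) (h : ∑ k, φ k ∘ₗ θ k = LinearMap.id) :
    (LinearMap.id : N' →ₗ[B] N') ∈ factorSpan B M' N' := by
  have : (LinearMap.id : N' →ₗ[B] N') = ∑ k, (eN.symm.toLinearMap ∘ₗ φ k ∘ₗ eM.toLinearMap) ∘ₗ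
      (eM.symm.toLinearMap ∘ₗ θ k ∘ₗ eN.toLinearMap) := by
    ext x
    have hx := LinearMap.congr_fun h (eN x)
    simp only [LinearMap.coe_sum, Finset.sum_apply, LinearMap.comp_apply, LinearMap.id_apply,
      LinearEquiv.coe_coe, LinearEquiv.apply_symm_apply] at hx ⊢
    rw [← map_sum, hx, LinearEquiv.symm_apply_apply]
  rw [this]
  exact Submodule.sum_mem _ fun k _ => Submodule.subset_span ⟨_, _, rfl⟩

/-- No proper ideal of `R` contained in `P` extends to the unit ideal of the completion of `R_P`. -/
theorem map_completedLocalization_ne_top {R : Type u} [CommRing R] (P : Ideal R) [P.IsPrime]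
    {J : Ideal R} (hJ : J ≤ P) :
    J.map (algebraMap R (CompletedLocalization P)) ≠ ⊤ := by
  intro h
  set m := IsLocalRing.maximalIdeal (Localization.AtPrime P)
  let g : CompletedLocalization P →+* Localization.AtPrime P ⧸ m :=
    (AdicCompletion.evalOneₐ m).toRingHom
  have hg : Ideal.map (g.comp (algebraMap R (CompletedLocalization P))) J = ⊤ := by
    rw [← Ideal.map_map, h, Ideal.map_top]
  have hle : Ideal.map (g.comp (algebraMap R (CompletedLocalization P))) J ≤ ⊥ := by
    rw [Ideal.map_le_iff_le_comap]
    intro x hx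
    change g (algebraMap R (CompletedLocalization P) x) = 0
    have hxm : algebraMap R (Localization.AtPrime P) x ∈ m := by
      rw [IsLocalization.AtPrime.to_map_mem_maximal_iff (Localization.AtPrime P) P]
      exact hJ hx
    exact Ideal.Quotient.eq_zero_iff_mem.mpr hxm
  rw [hg, top_le_iff] at hle
  have : m ≠ ⊤ := Ideal.IsPrime.ne_top'
  have : Nontrivial (Localization.AtPrime P ⧸ m) := Ideal.Quotient.nontrivial_iff.mpr this
  exact bot_ne_top hle

/-- The homomorphisms `F^{a+b}_* R → F^a_* R`, as a subgroup of the additive endomorphisms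
of `R`. -/
def negFrobHoms (p a b : ℕ) (R : Type u) [CommRing R] : AddSubgroup (AddMonoid.End R) where
  carrier := {θ | ∀ x u : R, θ (x ^ p ^ (a + b) * u) = x ^ p ^ a * θ u}
  add_mem' {φ ψ} hφ hψ x u := by
    change φ _ + ψ _ = _ * (φ u + ψ u)
    rw [hφ, hψ, mul_add]
  zero_mem' x u := by simp
  neg_mem' {φ} hφ x u := by
    change -(φ _) = _ * -(φ u)
    rw [hφ, mul_neg]

/-- A pair of families `φ k : F^a_* R → F^{a+b}_* R` and `θ k : F^{a+b}_* R → F^a_* R` with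
`∑ φ k θ k = 1`, exhibiting `F^{a+b}_* R` as a direct summand of a power of `F^a_* R`. It is the
same thing as a dual basis of the right module `Hom_R(F^a_* R, F^{a+b}_* R)` over
`End_R(F^a_* R)`. -/
structure FrobDualBasis (p a b : ℕ) (R : Type u) [CommRing R] where
  /-- The index set. -/
  ι : Type
  [fintype : Fintype ι]
  /-- The homomorphisms `F^a_* R → F^{a+b}_* R`. -/
  φ : ι → frobHoms p a b R 1
  /-- The homomorphisms `F^{a+b}_* R → F^a_* R`. -/
  θ : ι → negFrobHoms p a b R
  sum_eq : ∑ k, (φ k).1 * (θ k).1 = 1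

attribute [instance] FrobDualBasis.fintype

/-- Whether `F^{a+b}_* R` is a direct summand of a power of `F^a_* R` can be tested on the
completions of the local rings of `R`. -/
theorem nonempty_frobDualBasis (p : ℕ) [Fact p.Prime] (R : Type u) [CommRing R] [CharP R p]
    (hR : IsFFinite p R) (a b : ℕ) (hab : IsFFRTPair p R a b) :
    Nonempty (FrobDualBasis p a b R) := by
  obtain ⟨_, hfin⟩ := hR
  have hfin' := finite_frobPush p R hfin
  let M := FrobPush p a R R
  let N := FrobPush p (a + 1 * b) R R
  have : Module.Finite R M := hfin' _
  have : Module.Finite R N := hfin' _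
  have : Module.FinitePresentation R M := Module.finitePresentation_of_finite R M
  have : Module.FinitePresentation R N := Module.finitePresentation_of_finite R N
  have hid : (LinearMap.id : N →ₗ[R] N) ∈ factorSpan R M N := by
    set J : Ideal R := Submodule.comap
      (LinearMap.toSpanSingleton R (N →ₗ[R] N) LinearMap.id) (factorSpan R M N) with hJ
    suffices hJtop : J = ⊤ by
      have : (1 : R) ∈ J := hJtop ▸ Submodule.mem_top
      simpa [hJ] using this
    by_contra hne
    obtain ⟨P, hP, hJP⟩ := Ideal.exists_le_maximal J hne
    have := hP.isPrime
    let B := CompletedLocalization P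
    have : IsNoetherianRing (Localization.AtPrime P) :=
      IsLocalization.isNoetherianRing P.primeCompl _ ‹_›
    have : Module.Flat R (Localization.AtPrime P) := IsLocalization.flat _ P.primeCompl
    have : Module.Flat R B := Module.Flat.trans R (Localization.AtPrime P) B
    obtain ⟨eM⟩ := nonempty_completedLocalization_tensor_frobPush p (R := R) a P
    obtain ⟨eN⟩ := nonempty_completedLocalization_tensor_frobPush p (R := R) (a + 1 * b) P
    have : Module.Finite B (FrobPush p (a + 1 * b) B B) := Module.Finite.equiv eN
    obtain ⟨ι, _, φ, θ, hsum⟩ := exists_sum_comp_eq_id_of_indecComponents_subset B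
      (FrobPush p a B B) (FrobPush p (a + 1 * b) B B) (hab.2 P 1).subset
    exact map_completedLocalization_ne_top P hJP
      (map_colon_factorSpan_eq_top R B M N (id_mem_factorSpan_of_equiv eM eN φ θ hsum))
  obtain ⟨ι, _, φ, θ, hsum⟩ := exists_sum_comp_of_mem_factorSpan hid
  let tM := toFrobPush p a R R
  let tN := toFrobPush p (a + 1 * b) R R
  refine ⟨⟨ι,
    fun k => ⟨tN.symm.toAddMonoidHom.comp ((φ k).toAddMonoidHom.comp tM.toAddMonoidHom),
      fun x u => congrArg tN.symm ((φ k).map_smul x (tM u))⟩,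
    fun k => ⟨tM.symm.toAddMonoidHom.comp ((θ k).toAddMonoidHom.comp tN.toAddMonoidHom),
      fun x u => ?_⟩, ?_⟩⟩
  · have h : x ^ p ^ (a + b) * u = x ^ p ^ (a + 1 * b) * u := by rw [one_mul]
    rw [h]
    exact congrArg tM.symm ((θ k).map_smul x (tN u))
  · apply AddMonoidHom.ext
    intro u
    have h := LinearMap.congr_fun hsum (tN u)
    rw [LinearMap.sum_apply] at h
    exact (AddMonoidHom.finsetSum_apply _ _ _).trans
      ((map_sum tN.symm _ _).symm.trans (congrArg tN.symm h))

/-! ### A criterion for unit modules -/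

section Criterion

variable {p a b : ℕ} {R : Type u} [CommRing R]

/-- The inclusion of the homogeneous component of degree `i` into `D^{(0)}⟨Φ⟩`. -/
abbrev DPhi.homog (i : ℕ) : frobHoms p a b R i →+ DPhi p a b R :=
  DirectSum.of (fun i => frobHoms p a b R i) i

/-- Composition with a homomorphism `F^{a+b}_* R → F^a_* R` lowers the degree by one. -/
def lowerDegree {i : ℕ} (θ : negFrobHoms p a b R) (φ : frobHoms p a b R (i + 1)) :
    frobHoms p a b R i :=
  ⟨θ.1 * φ.1, fun x u => by
    have e1 : p ^ (a + (i + 1) * b) = p ^ (i * b) * p ^ (a + b) := by rw [← pow_add]; congr 1; ring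
    have e2 : p ^ (a + i * b) = p ^ (i * b) * p ^ a := by rw [← pow_add]; congr 1; ring
    change θ.1 (φ.1 _) = _ * θ.1 (φ.1 u)
    rw [φ.2 x u, e1, pow_mul, θ.2, ← pow_mul, ← e2]⟩

section Smul

variable {M : Type*} [AddCommGroup M] [Module (DPhi p a b R) M]

theorem homog_smul_homog_smul {i j k : ℕ} (h : i + j = k) (φ : frobHoms p a b R i)
    (ψ : frobHoms p a b R j) (χ : frobHoms p a b R k) (hχ : χ.1 = φ.1 * ψ.1) (m : M) :
    DPhi.homog i φ • DPhi.homog j ψ • m = DPhi.homog k χ • m := by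
  subst h
  rw [smul_smul, DPhi.of_mul_of]
  congr 2
  exact Subtype.ext hχ.symm

theorem homog_smul_eq_sum {i : ℕ} {κ : Type*} (s : Finset κ) (χ : frobHoms p a b R i)
    (f : κ → frobHoms p a b R i) (h : χ.1 = ∑ t ∈ s, (f t).1) (m : M) :
    DPhi.homog i χ • m = ∑ t ∈ s, DPhi.homog i (f t) • m := by
  rw [← Finset.sum_smul, ← map_sum]
  congr 2
  exact Subtype.ext (by rw [h, AddSubgroup.val_finsetSum])

variable (β : FrobDualBasis p a b R)

theorem FrobDualBasis.val_eq_sum {i : ℕ} (χ : frobHoms p a b R (i + 1)) :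
    χ.1 = ∑ k, (β.φ k).1 * (lowerDegree (β.θ k) χ).1 := by
  change χ.1 = ∑ k, (β.φ k).1 * ((β.θ k).1 * χ.1)
  simp_rw [← mul_assoc]
  rw [← Finset.sum_mul, β.sum_eq, one_mul]

/-- `χ = ∑ φ k (θ k χ)` for homogeneous `χ` of positive degree. In particular `D^{(0)}⟨Φ⟩` is
generated over `D^{(0)}` by its elements of degree one. -/
theorem FrobDualBasis.homog_smul {i : ℕ} (χ : frobHoms p a b R (i + 1)) (m : M) :
    DPhi.homog (i + 1) χ • m =
      ∑ k, DPhi.homog 1 (β.φ k) • DPhi.homog i (lowerDegree (β.θ k) χ) • m := by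
  have key : ∀ k, (β.φ k).1 * (lowerDegree (β.θ k) χ).1 ∈ frobHoms p a b R (i + 1) := fun k => by
    have := frobHoms_mul_mem (β.φ k).2 (lowerDegree (β.θ k) χ).2
    rwa [add_comm] at this
  rw [homog_smul_eq_sum Finset.univ χ (fun k => ⟨_, key k⟩) (β.val_eq_sum χ)]
  exact Finset.sum_congr rfl fun k _ =>
    (homog_smul_homog_smul (add_comm 1 i) (β.φ k) _ ⟨_, key k⟩ rfl m).symm

/-- `θ χ = ∑ (θ φ k) (θ k χ)`: the matrix `(θ k φ j)` over `D^{(0)}` is idempotent. -/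
theorem FrobDualBasis.lowerDegree_smul {i : ℕ} (θ : negFrobHoms p a b R)
    (χ : frobHoms p a b R (i + 1)) (m : M) :
    DPhi.homog i (lowerDegree θ χ) • m = ∑ k, DPhi.homog 0 (lowerDegree (i := 0) θ (β.φ k)) •
      DPhi.homog i (lowerDegree (β.θ k) χ) • m := by
  have key : ∀ k, (lowerDegree (i := 0) θ (β.φ k)).1 * (lowerDegree (β.θ k) χ).1 ∈
      frobHoms p a b R i := fun k => by
    have := frobHoms_mul_mem (lowerDegree (i := 0) θ (β.φ k)).2 (lowerDegree (β.θ k) χ).2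
    rwa [zero_add] at this
  rw [homog_smul_eq_sum Finset.univ (lowerDegree θ χ) (fun k => ⟨_, key k⟩)]
  · exact Finset.sum_congr rfl fun k _ =>
      (homog_smul_homog_smul (zero_add i) (lowerDegree (i := 0) θ (β.φ k)) _ ⟨_, key k⟩ rfl m).symm
  · change θ.1 * χ.1 = ∑ k, (θ.1 * (β.φ k).1) * (lowerDegree (β.θ k) χ).1
    rw [β.val_eq_sum χ, Finset.mul_sum]
    exact Finset.sum_congr rfl fun k _ => (mul_assoc _ _ _).symm

variable (M) in
/-- The operators `T k` on a unit module that correspond to the elements `θ k` of the dual basis: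
`D^{(0)}⟨Φ⟩` does not contain the homomorphisms `θ k` of degree `-1`, but they act on every unit
module. -/
structure DualAction where
  /-- The action of `θ k`. -/
  T : β.ι → M →+ M
  T_homog : ∀ k (φ : frobHoms p a b R 1) (m : M),
    T k (DPhi.homog 1 φ • m) = DPhi.homog 0 (lowerDegree (β.θ k) φ) • m
  sum_T : ∀ m, ∑ k, DPhi.homog 1 (β.φ k) • T k m = m

variable (M) in
/-- The contraction `Φ^*(M) → M`, `φ ⊗ m ↦ (θ φ) m`. -/
def contraction (θ : negFrobHoms p a b R) : PhiPullback p a b R M →+ M :=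
  QuotientAddGroup.lift (balancedRelations p a b R M)
    (TensorProduct.liftAddHom
      ((smulAddHom (DPhi p a b R) M).comp ((DPhi.homog 0).comp
        ({ toFun := fun φ => lowerDegree (i := 0) θ φ
           map_zero' := Subtype.ext (mul_zero _)
           map_add' := fun _ _ => Subtype.ext (mul_add _ _ _) } :
          frobHoms p a b R 1 →+ frobHoms p a b R 0)))
      (fun r φ m => by
        simp only [AddMonoidHom.comp_apply, map_zsmul, AddMonoidHom.zsmul_apply])) (by
    rw [balancedRelations, AddSubgroup.closure_le]
    rintro _ ⟨φ, d, m, rfl⟩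
    rw [SetLike.mem_coe, AddMonoidHom.mem_ker, map_sub, sub_eq_zero]
    exact (homog_smul_homog_smul (zero_add 0) (lowerDegree (i := 0) θ φ) d _
      (mul_assoc _ _ _).symm m).symm)

theorem contraction_tmul (θ : negFrobHoms p a b R) (φ : frobHoms p a b R 1) (m : M) :
    contraction M θ (QuotientAddGroup.mk (φ ⊗ₜ[ℤ] m)) =
      DPhi.homog 0 (lowerDegree (i := 0) θ φ) • m := rfl

/-- The class of `φ ⊗ m` in `Φ^*(M)`. -/
def PhiPullback.tmul (φ : frobHoms p a b R 1) : M →+ PhiPullback p a b R M :=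
  (QuotientAddGroup.mk' (balancedRelations p a b R M)).comp
    (TensorProduct.mk ℤ (frobHoms p a b R 1) M φ).toAddMonoidHom

theorem PhiPullback.tmul_homog_smul (φ : frobHoms p a b R 1) (d : frobHoms p a b R 0) (m : M) :
    PhiPullback.tmul φ (DPhi.homog 0 d • m) =
      PhiPullback.tmul ⟨φ.1 * d.1, frobHoms_mul_mem φ.2 d.2⟩ m := by
  rw [eq_comm, ← sub_eq_zero]
  exact (QuotientAddGroup.eq_zero_iff _).mpr (AddSubgroup.subset_closure ⟨φ, d, m, rfl⟩)

/-- `Φ^*(M)` is spanned by the elements `φ k ⊗ m`, since `φ ⊗ m = ∑ φ k ⊗ (θ k φ) m`. -/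
theorem FrobDualBasis.tmul_eq_sum (φ : frobHoms p a b R 1) (m : M) :
    PhiPullback.tmul φ m =
      ∑ k, PhiPullback.tmul (β.φ k) (DPhi.homog 0 (lowerDegree (i := 0) (β.θ k) φ) • m) := by
  simp_rw [PhiPullback.tmul_homog_smul]
  have h : φ = ∑ k, (⟨(β.φ k).1 * (lowerDegree (i := 0) (β.θ k) φ).1,
      frobHoms_mul_mem (β.φ k).2 (lowerDegree (i := 0) (β.θ k) φ).2⟩ : frobHoms p a b R 1) :=
    Subtype.ext (by rw [AddSubgroup.val_finsetSum]; exact β.val_eq_sum (i := 0) φ)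
  conv_lhs => rw [h]
  change QuotientAddGroup.mk' (balancedRelations p a b R M) ((∑ k, _) ⊗ₜ[ℤ] m) = _
  rw [TensorProduct.sum_tmul, map_sum]
  rfl

theorem FrobDualBasis.exists_eq_sum_tmul (x : PhiPullback p a b R M) :
    ∃ n : β.ι → M, x = ∑ k, PhiPullback.tmul (β.φ k) (n k) := by
  obtain ⟨t, rfl⟩ := QuotientAddGroup.mk'_surjective _ x
  induction t with
  | zero => exact ⟨0, by simp⟩
  | add x y hx hy =>
    obtain ⟨n, hn⟩ := hx
    obtain ⟨n', hn'⟩ := hy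
    exact ⟨n + n', by rw [map_add, hn, hn']; simp [Finset.sum_add_distrib]⟩
  | tmul φ m => exact ⟨_, β.tmul_eq_sum φ m⟩

/-- On a unit module the elements of the dual basis act. -/
theorem IsUnitModule.nonempty_dualAction (h : IsUnitModule p a b R M) :
    Nonempty (DualAction M β) := by
  let E := AddEquiv.ofBijective (structureMap p a b R M) h
  have hE : ∀ φ (m : M), E.symm (DPhi.homog 1 φ • m) = PhiPullback.tmul φ m := fun φ m => by
    rw [AddEquiv.symm_apply_eq]; rfl
  refine ⟨⟨fun k => (contraction M (β.θ k)).comp E.symm.toAddMonoidHom, fun k φ m => ?_,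
    fun m => ?_⟩⟩
  · change contraction M (β.θ k) (E.symm _) = _
    rw [hE]
    exact contraction_tmul _ _ _
  · obtain ⟨x, rfl⟩ := E.surjective m
    obtain ⟨n, rfl⟩ := β.exists_eq_sum_tmul x
    change ∑ k, DPhi.homog 1 (β.φ k) • contraction M (β.θ k) (E.symm (E _)) = _
    have h1 : ∀ n : β.ι → M, E (∑ k, PhiPullback.tmul (β.φ k) (n k)) =
        ∑ k, DPhi.homog 1 (β.φ k) • n k := fun n => by rw [map_sum]; rfl
    simp_rw [AddEquiv.symm_apply_apply, map_sum, Finset.smul_sum]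
    rw [Finset.sum_comm]
    refine Finset.sum_congr rfl fun j _ => ?_
    exact (β.homog_smul (i := 0) (β.φ j) (n j)).symm

/-- An elementary criterion: `M` is unit if and only if every element has the form `∑ φ k m k`, and
each relation `∑ φ j m j = 0` follows from the relations `∑ j, (θ k φ j) m j = 0` over
`D^{(0)}`. -/
theorem isUnitModule_iff : IsUnitModule p a b R M ↔
    (∀ m : M, ∃ n : β.ι → M, ∑ k, DPhi.homog 1 (β.φ k) • n k = m) ∧
    ∀ n : β.ι → M, ∑ j, DPhi.homog 1 (β.φ j) • n j = 0 →
      ∀ k, ∑ j, DPhi.homog 0 (lowerDegree (i := 0) (β.θ k) (β.φ j)) • n j = 0 := by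
  constructor
  · intro h
    obtain ⟨t⟩ := h.nonempty_dualAction β
    refine ⟨fun m => ⟨fun k => t.T k m, t.sum_T m⟩, fun n hn k => ?_⟩
    rw [← map_zero (t.T k), ← hn, map_sum]
    exact Finset.sum_congr rfl fun j _ => (t.T_homog k (β.φ j) (n j)).symm
  · rintro ⟨h1, h2⟩
    constructor
    · rw [injective_iff_map_eq_zero]
      intro x hx
      obtain ⟨n, rfl⟩ := β.exists_eq_sum_tmul x
      rw [map_sum] at hx
      have h3 := h2 n hx
      calc ∑ j, PhiPullback.tmul (β.φ j) (n j)
          = ∑ j, ∑ k, PhiPullback.tmul (β.φ k)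
              (DPhi.homog 0 (lowerDegree (i := 0) (β.θ k) (β.φ j)) • n j) :=
            Finset.sum_congr rfl fun j _ => β.tmul_eq_sum (β.φ j) (n j)
        _ = ∑ k, PhiPullback.tmul (β.φ k)
              (∑ j, DPhi.homog 0 (lowerDegree (i := 0) (β.θ k) (β.φ j)) • n j) := by
            rw [Finset.sum_comm]
            exact Finset.sum_congr rfl fun k _ => (map_sum _ _ _).symm
        _ = 0 := Finset.sum_eq_zero fun k _ => by rw [h3 k, map_zero]
    · intro m
      obtain ⟨n, rfl⟩ := h1 m
      exact ⟨∑ k, PhiPullback.tmul (β.φ k) (n k), by rw [map_sum]; rfl⟩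

variable {β} in
/-- The operators of a dual action commute with homomorphisms of unit modules. -/
theorem DualAction.map_T {N : Type*} [AddCommGroup N] [Module (DPhi p a b R) N]
    (t : DualAction M β) (s : DualAction N β) (f : M →ₗ[DPhi p a b R] N) (k : β.ι) (m : M) :
    f (t.T k m) = s.T k (f m) := by
  have h1 := congrArg (fun x => f (t.T k x)) (t.sum_T m)
  have h2 := congrArg (fun x => s.T k (f x)) (t.sum_T m)
  simp only [map_sum, map_smul, t.T_homog, s.T_homog] at h1 h2
  rw [← h1, ← h2]

end Smul

/-! ### Kernels, cokernels and extensions of unit modules -/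

section Exact

variable {M₁ M₂ M₃ : Type*} [AddCommGroup M₁] [AddCommGroup M₂] [AddCommGroup M₃]
  [Module (DPhi p a b R) M₁] [Module (DPhi p a b R) M₂] [Module (DPhi p a b R) M₃]
  (f : M₁ →ₗ[DPhi p a b R] M₂) (g : M₂ →ₗ[DPhi p a b R] M₃) (β : FrobDualBasis p a b R)

include β in
theorem isUnitModule_of_kernel (hf : Function.Injective f) (hfg : Function.Exact f g)
    (h₂ : IsUnitModule p a b R M₂) (h₃ : IsUnitModule p a b R M₃) : IsUnitModule p a b R M₁ := by
  obtain ⟨t₂⟩ := h₂.nonempty_dualAction β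
  obtain ⟨t₃⟩ := h₃.nonempty_dualAction β
  rw [isUnitModule_iff β] at h₂ ⊢
  constructor
  · intro m
    -- `g (T k (f m)) = T k (g (f m)) = 0`, so the coefficients `T k (f m)` come from `M₁`
    have : ∀ k, ∃ n, f n = t₂.T k (f m) := fun k =>
      (hfg _).mp (by rw [t₂.map_T t₃, hfg.apply_apply_eq_zero, map_zero])
    choose n hn using this
    refine ⟨n, hf ?_⟩
    simp only [map_sum, map_smul, hn]
    exact t₂.sum_T (f m)
  · intro n hn k
    apply hf
    have := h₂.2 (fun k => f (n k)) (by simpa using congrArg f hn) k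
    simpa using this

include β in
theorem isUnitModule_of_cokernel (hg : Function.Surjective g) (hfg : Function.Exact f g)
    (h₁ : IsUnitModule p a b R M₁) (h₂ : IsUnitModule p a b R M₂) : IsUnitModule p a b R M₃ := by
  obtain ⟨t₁⟩ := h₁.nonempty_dualAction β
  obtain ⟨t₂⟩ := h₂.nonempty_dualAction β
  rw [isUnitModule_iff β] at h₂ ⊢
  constructor
  · intro m
    obtain ⟨m, rfl⟩ := hg m
    obtain ⟨n, rfl⟩ := h₂.1 m
    exact ⟨fun k => g (n k), by simp⟩
  · intro n hn k
    choose n' hn' using fun k => hg (n k)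
    obtain rfl : (fun k => g (n' k)) = n := funext hn'
    obtain ⟨m, hm⟩ := (hfg (∑ j, DPhi.homog 1 (β.φ j) • n' j)).mp (by simpa using hn)
    have h : g (t₂.T k (f m)) = 0 := by rw [← t₁.map_T t₂, hfg.apply_apply_eq_zero]
    rw [hm] at h
    simpa only [map_sum, t₂.T_homog, map_smul] using h

include β in
theorem isUnitModule_of_extension (hf : Function.Injective f) (hg : Function.Surjective g)
    (hfg : Function.Exact f g) (h₁ : IsUnitModule p a b R M₁) (h₃ : IsUnitModule p a b R M₃) :
    IsUnitModule p a b R M₂ := by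
  rw [isUnitModule_iff β] at h₁ h₃ ⊢
  constructor
  · intro m
    obtain ⟨n, hn⟩ := h₃.1 (g m)
    choose n' hn' using fun k => hg (n k)
    obtain rfl : (fun k => g (n' k)) = n := funext hn'
    obtain ⟨m₁, hm₁⟩ := (hfg (m - ∑ k, DPhi.homog 1 (β.φ k) • n' k)).mp (by
      rw [map_sub, sub_eq_zero, ← hn]; simp)
    obtain ⟨l, rfl⟩ := h₁.1 m₁
    refine ⟨fun k => f (l k) + n' k, ?_⟩
    simp only [smul_add, Finset.sum_add_distrib]
    rw [← sub_add_cancel m (∑ k, DPhi.homog 1 (β.φ k) • n' k), ← hm₁]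
    simp
  · intro n hn k
    have h := h₃.2 (fun k => g (n k)) (by simpa using congrArg g hn)
    have : ∀ k, ∃ l, f l = ∑ j, DPhi.homog 0 (lowerDegree (i := 0) (β.θ k) (β.φ j)) • n j :=
      fun k => (hfg _).mp (by simpa using h k)
    choose l hl using this
    -- applying `∑ φ k` to the coefficients does not change the sum, because `∑ φ k θ k = 1`
    have hsum : ∀ n : β.ι → M₂, ∑ k, DPhi.homog 1 (β.φ k) •
        ∑ j, DPhi.homog 0 (lowerDegree (i := 0) (β.θ k) (β.φ j)) • n j =
          ∑ j, DPhi.homog 1 (β.φ j) • n j := fun n => by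
      simp_rw [Finset.smul_sum]
      rw [Finset.sum_comm]
      exact Finset.sum_congr rfl fun j _ => (β.homog_smul (i := 0) (β.φ j) (n j)).symm
    have hl0 : ∑ k, DPhi.homog 1 (β.φ k) • l k = 0 := by
      apply hf
      simp only [map_sum, map_smul, hl, map_zero]
      rw [hsum, hn]
    have := h₁.2 l hl0 k
    apply_fun f at this
    simp only [map_sum, map_smul, hl, map_zero, Finset.smul_sum] at this
    rw [Finset.sum_comm] at this
    rw [← this]
    exact Finset.sum_congr rfl fun j _ => β.lowerDegree_smul (i := 0) (β.θ k) (β.φ j) (n j)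

end Exact

end Criterion

/-! ### Finiteness of unit modules over the base ring -/

section Finiteness

variable {p a b : ℕ} {R : Type u} [CommRing R]

/-- Multiplication by `r`, as an element of `D^{(0)}`. -/
def mulHom (r : R) : frobHoms p a b R 0 :=
  ⟨AddMonoidHom.mulLeft r, fun x u => by
    change r * (_ * u) = _ * (r * u)
    rw [zero_mul, add_zero, mul_left_comm]⟩

/-- The ring homomorphism `R → D^{(0)}⟨Φ⟩` given by multiplications. -/
def toDPhi : R →+* DPhi p a b R where
  toFun r := DPhi.homog 0 (mulHom r)
  map_one' := congrArg (DPhi.homog 0) (Subtype.ext (AddMonoidHom.ext fun u => one_mul u))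
  map_zero' := by
    rw [← map_zero (DPhi.homog 0)]
    exact congrArg (DPhi.homog 0) (Subtype.ext (AddMonoidHom.ext fun u => zero_mul u))
  map_mul' r s := by
    rw [DPhi.of_mul_of]
    exact congrArg (DPhi.homog 0) (Subtype.ext (AddMonoidHom.ext fun u => mul_assoc r s u))
  map_add' r s := by
    rw [← map_add]
    exact congrArg (DPhi.homog 0) (Subtype.ext (AddMonoidHom.ext fun u => add_mul r s u))

/-- `Hom_R(F^a_* R, F^{a+ib}_* R)` is finitely generated for the multiplication by `R` on the
target: evaluation at generators of `F^a_* R` embeds it into a finite free `R`-module. -/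
theorem exists_finite_generators_frobHoms [ExpChar R p] [IsNoetherianRing R]
    [Module.Finite R (FrobPush p a R R)] (i : ℕ) :
    ∃ (n : ℕ) (ψ : Fin n → frobHoms p a b R i), ∀ φ : frobHoms p a b R i,
      ∃ c : Fin n → R, φ.1 = ∑ t, (mulHom (p := p) (a := a) (b := b) (c t)).1 * (ψ t).1 := by
  obtain ⟨l, w, hw⟩ := Module.Finite.exists_fin (R := R) (M := FrobPush p a R R)
  let y : Fin l → R := fun j => (toFrobPush p a R R).symm (w j)
  have hinj : ∀ φ ψ : AddMonoid.End R, φ ∈ frobHoms p a b R i → ψ ∈ frobHoms p a b R i →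
      (∀ j, φ (y j) = ψ (y j)) → φ = ψ := by
    intro φ ψ hφ hψ h
    apply AddMonoidHom.ext
    intro x
    have hx : toFrobPush p a R R x ∈ Submodule.span R (Set.range w) := hw ▸ Submodule.mem_top
    obtain ⟨c, hc⟩ := (Submodule.mem_span_range_iff_exists_fun R).mp hx
    have hx' : x = ∑ j, c j ^ p ^ a * y j := by
      have := congrArg (toFrobPush p a R R).symm hc
      rw [map_sum] at this
      exact this.symm
    rw [hx']
    change φ _ = ψ _
    rw [map_sum, map_sum]
    exact Finset.sum_congr rfl fun j _ => by rw [hφ, hψ, h]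
  let K : Submodule R (Fin l → R) :=
    { carrier := {v | ∃ φ : frobHoms p a b R i, v = fun j => φ.1 (y j)}
      add_mem' := by
        rintro _ _ ⟨φ, rfl⟩ ⟨ψ, rfl⟩
        exact ⟨φ + ψ, rfl⟩
      zero_mem' := ⟨0, rfl⟩
      smul_mem' := by
        rintro r _ ⟨φ, rfl⟩
        refine ⟨⟨(mulHom (p := p) (a := a) (b := b) r).1 * φ.1, ?_⟩, rfl⟩
        have := frobHoms_mul_mem (mulHom (p := p) (a := a) (b := b) r).2 φ.2
        rwa [zero_add] at this }
  obtain ⟨n, v, hv⟩ := Submodule.fg_iff_exists_fin_generating_family.mp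
    (IsNoetherian.noetherian K)
  have hvK : ∀ t, v t ∈ K := fun t => hv ▸ Submodule.subset_span ⟨t, rfl⟩
  choose ψ hψ using hvK
  refine ⟨n, ψ, fun φ => ?_⟩
  have hφ : (fun j => φ.1 (y j)) ∈ Submodule.span R (Set.range v) := by
    rw [hv]
    exact ⟨φ, rfl⟩
  obtain ⟨c, hc⟩ := (Submodule.mem_span_range_iff_exists_fun R).mp hφ
  refine ⟨c, hinj _ _ φ.2 (sum_mem fun t _ => ?_) fun j => ?_⟩
  · have := frobHoms_mul_mem (mulHom (p := p) (a := a) (b := b) (c t)).2 (ψ t).2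
    rwa [zero_add] at this
  · have := congrFun hc j
    simp only [hψ, Finset.sum_apply, Pi.smul_apply, smul_eq_mul] at this
    rw [← this]
    exact (AddMonoidHom.finsetSum_apply (M := R) (N := R)
      (fun t => (mulHom (p := p) (a := a) (b := b) (c t)).1 * (ψ t).1) Finset.univ (y j)).symm

section Degree

variable {M : Type v} [AddCommGroup M] [Module (DPhi p a b R) M]

/-- The elements `φ g` with `g ∈ G` and `φ` homogeneous of degree at most `r`. -/
def degreeLE (p a b : ℕ) (R : Type u) [CommRing R] [Module (DPhi p a b R) M] (G : Set M) (r : ℕ) :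
    Set M :=
  {m | ∃ i ≤ r, ∃ φ : frobHoms p a b R i, ∃ g ∈ G, m = DPhi.homog i φ • g}

theorem degreeLE_mono (G : Set M) {r s : ℕ} (h : r ≤ s) :
    degreeLE p a b R G r ⊆ degreeLE p a b R G s := by
  rintro _ ⟨i, hi, φ, g, hg, rfl⟩
  exact ⟨i, hi.trans h, φ, g, hg, rfl⟩

/-- Composition of homogeneous elements. -/
def homogMul {i j : ℕ} (φ : frobHoms p a b R i) (ψ : frobHoms p a b R j) :
    frobHoms p a b R (i + j) :=
  ⟨φ.1 * ψ.1, frobHoms_mul_mem φ.2 ψ.2⟩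

theorem homog_smul_homog_smul_eq {i j : ℕ} (φ : frobHoms p a b R i) (ψ : frobHoms p a b R j)
    (m : M) : DPhi.homog i φ • DPhi.homog j ψ • m = DPhi.homog (i + j) (homogMul φ ψ) • m :=
  homog_smul_homog_smul rfl φ ψ _ rfl m

end Degree

variable {M : Type v} [AddCommGroup M] [Module (DPhi p a b R) M]

section Iterate

variable {β : FrobDualBasis p a b R} (t : DualAction M β)

/-- `T k (χ m) = (θ k χ) m` for homogeneous `χ` of any positive degree. -/
theorem DualAction.T_homog_succ {i : ℕ} (k : β.ι) (χ : frobHoms p a b R (i + 1)) (m : M) :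
    t.T k (DPhi.homog (i + 1) χ • m) = DPhi.homog i (lowerDegree (β.θ k) χ) • m := by
  rw [β.homog_smul χ m, map_sum, β.lowerDegree_smul (β.θ k) χ m]
  exact Finset.sum_congr rfl fun j _ => t.T_homog k (β.φ j) _

/-- The elements that every composition of `n` of the operators `T k` maps into `N`. -/
def DualAction.iteratedPreimage (N : AddSubgroup M) : ℕ → AddSubgroup M
  | 0 => N
  | n + 1 => ⨅ k, (DualAction.iteratedPreimage N n).comap (t.T k)

theorem DualAction.mem_iteratedPreimage_succ {N : AddSubgroup M} {n : ℕ} {m : M} :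
    m ∈ t.iteratedPreimage N (n + 1) ↔ ∀ k, t.T k m ∈ t.iteratedPreimage N n := by
  simp [iteratedPreimage]

theorem DualAction.iteratedPreimage_mono {N : AddSubgroup M} (hN : ∀ k, ∀ m ∈ N, t.T k m ∈ N) :
    Monotone (t.iteratedPreimage N) := by
  refine monotone_nat_of_le_succ fun n => ?_
  induction n with
  | zero => exact fun m hm => t.mem_iteratedPreimage_succ.mpr fun k => hN k m hm
  | succ n ih =>
    exact fun m hm => t.mem_iteratedPreimage_succ.mpr fun k =>
      ih (t.mem_iteratedPreimage_succ.mp hm k)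

theorem DualAction.homog_smul_mem_iteratedPreimage {N : AddSubgroup M}
    (hN : ∀ (d : frobHoms p a b R 0), ∀ m ∈ N, DPhi.homog 0 d • m ∈ N) (i : ℕ)
    (φ : frobHoms p a b R i) {m : M} (hm : m ∈ N) :
    DPhi.homog i φ • m ∈ t.iteratedPreimage N i := by
  induction i with
  | zero => exact hN φ m hm
  | succ i ih =>
    rw [t.mem_iteratedPreimage_succ]
    intro k
    rw [t.T_homog_succ]
    exact ih _

/-- Writing `m = ∑ φ k (T k m)` repeatedly expresses an element of a stable submodule `L` through
elements of `N ∩ L`. -/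
theorem DualAction.mem_span_inter_of_mem_iteratedPreimage {N : AddSubgroup M}
    {L : Submodule (DPhi p a b R) M} (hL : ∀ k, ∀ m ∈ L, t.T k m ∈ L) (n : ℕ) {m : M}
    (hm : m ∈ t.iteratedPreimage N n) (hmL : m ∈ L) :
    m ∈ Submodule.span (DPhi p a b R) ((N : Set M) ∩ L) := by
  induction n generalizing m with
  | zero => exact Submodule.subset_span ⟨hm, hmL⟩
  | succ n ih =>
    rw [t.mem_iteratedPreimage_succ] at hm
    rw [← t.sum_T m]
    exact sum_mem fun k _ => Submodule.smul_mem _ _ (ih (hm k) (hL k m hmL))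

end Iterate

section BaseRing

variable [Module R M] (hsmul : ∀ (r : R) (m : M), r • m = toDPhi (p := p) (a := a) (b := b) r • m)

include hsmul in
theorem span_degreeLE_fg [ExpChar R p] [IsNoetherianRing R] [Module.Finite R (FrobPush p a R R)]
    {G : Set M} (hG : G.Finite) (r : ℕ) : (Submodule.span R (degreeLE p a b R G r)).FG := by
  choose n ψ hψ using fun i =>
    exists_finite_generators_frobHoms (p := p) (a := a) (b := b) (R := R) i
  let F : Set M := ⋃ i ∈ Set.Iic r, ⋃ g ∈ G, Set.range fun t => DPhi.homog i (ψ i t) • g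
  have hF : F.Finite := (Set.finite_Iic r).biUnion fun i _ => hG.biUnion fun g _ =>
    Set.finite_range _
  have hle : Submodule.span R (degreeLE p a b R G r) ≤ Submodule.span R F := by
    rw [Submodule.span_le]
    rintro _ ⟨i, hi, φ, g, hg, rfl⟩
    obtain ⟨c, hc⟩ := hψ i φ
    have key : ∀ t, (mulHom (p := p) (a := a) (b := b) (c t)).1 * (ψ i t).1 ∈
        frobHoms p a b R i := fun t => by
      have := frobHoms_mul_mem (mulHom (p := p) (a := a) (b := b) (c t)).2 (ψ i t).2
      rwa [zero_add] at this
    rw [homog_smul_eq_sum Finset.univ φ (fun t => ⟨_, key t⟩) hc]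
    refine sum_mem fun t _ => ?_
    rw [← homog_smul_homog_smul (zero_add i) (mulHom (c t)) (ψ i t) ⟨_, key t⟩ rfl g]
    have := Submodule.smul_mem (Submodule.span R F) (c t) (Submodule.subset_span
      (Set.mem_biUnion (show i ∈ Set.Iic r from hi) (Set.mem_biUnion hg ⟨t, rfl⟩)))
    rwa [hsmul] at this
  have : IsNoetherian R (Submodule.span R F) := isNoetherian_span_of_finite R hF
  exact (isNoetherian_submodule.mp this) _ hle

include hsmul in
/-- An additive property that holds for the elements `φ g` with `φ` homogeneous of degree at
most `r` holds on the `R`-module that they generate. -/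
theorem span_degreeLE_induction {G : Set M} {r : ℕ} {P : M → Prop} (h0 : P 0)
    (hadd : ∀ x y, P x → P y → P (x + y))
    (hmem : ∀ i ≤ r, ∀ (φ : frobHoms p a b R i), ∀ g ∈ G, P (DPhi.homog i φ • g))
    {m : M} (hm : m ∈ Submodule.span R (degreeLE p a b R G r)) : P m := by
  induction hm using Submodule.closure_induction with
  | zero => exact h0
  | add x y _ _ hx hy => exact hadd x y hx hy
  | smul_mem c x hx =>
    obtain ⟨i, hi, φ, g, hg, rfl⟩ := hx
    rw [hsmul]
    change P (DPhi.homog 0 (mulHom c) • DPhi.homog i φ • g)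
    rw [homog_smul_homog_smul_eq]
    exact hmem _ (by omega) _ g hg

include hsmul in
theorem homog_smul_mem_span_degreeLE {G : Set M} {r j : ℕ} (ψ : frobHoms p a b R j) {m : M}
    (hm : m ∈ Submodule.span R (degreeLE p a b R G r)) :
    DPhi.homog j ψ • m ∈ Submodule.span R (degreeLE p a b R G (j + r)) := by
  refine span_degreeLE_induction hsmul
    (P := fun m => DPhi.homog j ψ • m ∈ Submodule.span R (degreeLE p a b R G (j + r)))
    ?_ ?_ ?_ hm
  · rw [smul_zero]; exact zero_mem _
  · intro x y hx hy
    rw [smul_add]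
    exact add_mem hx hy
  · intro i hi φ g hg
    rw [homog_smul_homog_smul_eq]
    exact Submodule.subset_span ⟨j + i, by omega, _, g, hg, rfl⟩

include hsmul in
/-- If `G` generates `M` over `D^{(0)}⟨Φ⟩`, then `M` is the union of the `R`-submodules generated
by the elements `φ g` with `φ` of bounded degree. -/
theorem exists_mem_span_degreeLE {G : Set M} (hG : Submodule.span (DPhi p a b R) G = ⊤) (m : M) :
    ∃ r, m ∈ Submodule.span R (degreeLE p a b R G r) := by
  have hadd : ∀ x y : M, (∃ r, x ∈ Submodule.span R (degreeLE p a b R G r)) →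
      (∃ r, y ∈ Submodule.span R (degreeLE p a b R G r)) →
      ∃ r, x + y ∈ Submodule.span R (degreeLE p a b R G r) := by
    rintro x y ⟨r, hr⟩ ⟨s, hs⟩
    exact ⟨max r s, add_mem (Submodule.span_mono (degreeLE_mono G (le_max_left r s)) hr)
      (Submodule.span_mono (degreeLE_mono G (le_max_right r s)) hs)⟩
  have hm : m ∈ Submodule.span (DPhi p a b R) G := hG ▸ Submodule.mem_top
  induction hm using Submodule.span_induction with
  | mem g hg =>
    refine ⟨0, Submodule.subset_span ⟨0, le_rfl, mulHom 1, g, hg, ?_⟩⟩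
    change g = toDPhi (p := p) (a := a) (b := b) (1 : R) • g
    rw [map_one, one_smul]
  | zero => exact ⟨0, zero_mem _⟩
  | add x y _ _ hx hy => exact hadd x y hx hy
  | smul d x _ hx =>
    induction d using DirectSum.induction_on with
    | zero =>
      refine ⟨0, ?_⟩
      have h0 : (0 : DPhi p a b R) • x = 0 := zero_smul (DPhi p a b R) x
      exact h0 ▸ zero_mem _
    | of j ψ =>
      obtain ⟨r, hr⟩ := hx
      exact ⟨j + r, homog_smul_mem_span_degreeLE hsmul ψ hr⟩
    | add d d' h h' => rw [add_smul]; exact hadd _ _ h h'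

variable {β : FrobDualBasis p a b R} (t : DualAction M β)

include hsmul in
/-- If the operators `T k` map `G` into the `R`-module generated by the elements `φ g` with `φ` of
degree at most `r`, then they preserve this module. -/
theorem DualAction.T_mem_span_degreeLE {G : Set M} {r : ℕ}
    (hT : ∀ k, ∀ g ∈ G, t.T k g ∈ Submodule.span R (degreeLE p a b R G r)) (k : β.ι) {m : M}
    (hm : m ∈ Submodule.span R (degreeLE p a b R G r)) :
    t.T k m ∈ Submodule.span R (degreeLE p a b R G r) := by
  refine span_degreeLE_induction hsmul
    (P := fun m => t.T k m ∈ Submodule.span R (degreeLE p a b R G r)) ?_ ?_ ?_ hm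
  · rw [map_zero]; exact zero_mem _
  · intro x y hx hy
    rw [map_add]
    exact add_mem hx hy
  · intro i hi φ g hg
    cases i with
    | zero =>
      -- rewrite `d g` as `∑ l, (d φ l) (T l g)`, so that `T k` applies to elements of degree one
      rw [← t.sum_T g, Finset.smul_sum, map_sum]
      refine sum_mem fun l _ => ?_
      rw [homog_smul_homog_smul (zero_add 1) φ (β.φ l)
        ⟨φ.1 * (β.φ l).1, by have := frobHoms_mul_mem φ.2 (β.φ l).2; rwa [zero_add] at this⟩ rfl,
        t.T_homog]
      have := homog_smul_mem_span_degreeLE hsmul (lowerDegree (i := 0) (β.θ k)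
        ⟨φ.1 * (β.φ l).1, by have := frobHoms_mul_mem φ.2 (β.φ l).2; rwa [zero_add] at this⟩)
        (hT l g hg)
      rwa [zero_add] at this
    | succ i =>
      rw [t.T_homog_succ]
      exact Submodule.subset_span ⟨i, by omega, _, g, hg, rfl⟩

/-- A `D^{(0)}⟨Φ⟩`-submodule, regarded as an `R`-submodule. -/
def baseSubmodule (L : Submodule (DPhi p a b R) M) : Submodule R M where
  carrier := L
  add_mem' := L.add_mem
  zero_mem' := L.zero_mem
  smul_mem' r x hx := by
    rw [hsmul]
    exact L.smul_mem (toDPhi r) hx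

include hsmul in
/-- A finitely generated unit module `M` has a finitely generated `R`-submodule `N` such that every
unit submodule of `M` is generated by its intersection with `N`. Unit submodules are given here as
ranges of injective homomorphisms `f` from unit modules. -/
theorem exists_fg_forall_span_inter_eq [ExpChar R p] [IsNoetherianRing R]
    [Module.Finite R (FrobPush p a R R)] (β : FrobDualBasis p a b R)
    [Module.Finite (DPhi p a b R) M] (hM : IsUnitModule p a b R M) :
    ∃ N : Submodule R M, N.FG ∧ ∀ {L : Type v} [AddCommGroup L] [Module (DPhi p a b R) L]
      (f : L →ₗ[DPhi p a b R] M), IsUnitModule p a b R L →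
      Submodule.span (DPhi p a b R) ((N : Set M) ∩ LinearMap.range f) = LinearMap.range f := by
  obtain ⟨t⟩ := hM.nonempty_dualAction β
  obtain ⟨G, hG⟩ := Module.Finite.fg_top (R := DPhi p a b R) (M := M)
  choose r hr using exists_mem_span_degreeLE hsmul hG
  -- a degree bound for the finitely many elements `T k g` with `g ∈ G`
  let s : ℕ := Finset.univ.sup fun k => G.sup fun g => r (t.T k g)
  let N := Submodule.span R (degreeLE p a b R (G : Set M) s)
  have hTG : ∀ k, ∀ g ∈ (G : Set M), t.T k g ∈ N := fun k g hg =>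
    Submodule.span_mono (degreeLE_mono _
      ((Finset.le_sup (f := fun g => r (t.T k g)) hg).trans
        (Finset.le_sup (f := fun k => G.sup fun g => r (t.T k g)) (Finset.mem_univ k)))) (hr _)
  have hTN : ∀ k, ∀ m ∈ N.toAddSubgroup, t.T k m ∈ N.toAddSubgroup := fun k m hm =>
    t.T_mem_span_degreeLE hsmul hTG k hm
  have hDN : ∀ (d : frobHoms p a b R 0), ∀ m ∈ N.toAddSubgroup,
      DPhi.homog 0 d • m ∈ N.toAddSubgroup := fun d m hm => by
    have := homog_smul_mem_span_degreeLE hsmul d hm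
    rwa [zero_add] at this
  have hGN : ∀ g ∈ (G : Set M), g ∈ N.toAddSubgroup := fun g hg => by
    refine Submodule.subset_span ⟨0, Nat.zero_le _, mulHom 1, g, hg, ?_⟩
    change g = toDPhi (p := p) (a := a) (b := b) (1 : R) • g
    rw [map_one, one_smul]
  -- compositions of as many operators `T k` as the degree bound of `m` map `m` into `N`
  have hexh : ∀ m, m ∈ t.iteratedPreimage N.toAddSubgroup (r m) := fun m =>
    span_degreeLE_induction hsmul (P := fun x => x ∈ t.iteratedPreimage N.toAddSubgroup (r m))
      (zero_mem _) (fun _ _ => add_mem)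
      (fun i hi φ g hg => t.iteratedPreimage_mono hTN hi
        (t.homog_smul_mem_iteratedPreimage hDN i φ (hGN g hg))) (hr m)
  refine ⟨N, span_degreeLE_fg hsmul G.finite_toSet s, fun {L} _ _ f hL => le_antisymm ?_ ?_⟩
  · exact Submodule.span_le.mpr Set.inter_subset_right
  · obtain ⟨t'⟩ := hL.nonempty_dualAction β
    have hTL : ∀ k, ∀ m ∈ LinearMap.range f, t.T k m ∈ LinearMap.range f := by
      rintro k _ ⟨x, rfl⟩
      exact ⟨t'.T k x, t'.map_T t f k x⟩
    intro m hm
    have h := t.mem_span_inter_of_mem_iteratedPreimage (N := N.toAddSubgroup) hTL (r m) (hexh m) hm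
    rwa [Submodule.coe_toAddSubgroup] at h

end BaseRing

end Finiteness

section Noetherian

variable {p a b : ℕ} {R : Type u} [CommRing R] [ExpChar R p] [IsNoetherianRing R]
  [Module.Finite R (FrobPush p a R R)] (β : FrobDualBasis p a b R)
  {M : Type v} [AddCommGroup M] [Module (DPhi p a b R) M] [Module.Finite (DPhi p a b R) M]
  (hM : IsUnitModule p a b R M)

include β hM

/-- Unit submodules of finitely generated unit modules are finitely generated. -/
theorem finite_of_isUnitModule_of_injective {L : Type v} [AddCommGroup L]
    [Module (DPhi p a b R) L] (f : L →ₗ[DPhi p a b R] M) (hf : Function.Injective f)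
    (hL : IsUnitModule p a b R L) : Module.Finite (DPhi p a b R) L := by
  let _ : Module R M := Module.compHom M (toDPhi (p := p) (a := a) (b := b) (R := R))
  have hsmul : ∀ (r : R) (m : M), r • m = toDPhi (p := p) (a := a) (b := b) r • m :=
    fun _ _ => rfl
  obtain ⟨N, hN, hspan⟩ := exists_fg_forall_span_inter_eq hsmul β hM
  let L' : Submodule R M := baseSubmodule hsmul (LinearMap.range f)
  have := isNoetherian_of_fg_of_noetherian N hN
  obtain ⟨S, hS⟩ := (isNoetherian_submodule.mp this) (N ⊓ L') inf_le_left
  have hfg : (LinearMap.range f).FG := by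
    refine ⟨S, le_antisymm ?_ ?_⟩
    · rw [Submodule.span_le]
      intro x hx
      have : x ∈ N ⊓ L' := hS ▸ Submodule.subset_span hx
      exact this.2
    · rw [← hspan f hL, Submodule.span_le]
      intro x hx
      have hx' : x ∈ Submodule.span R (S : Set M) := hS ▸ hx
      clear hx
      induction hx' using Submodule.closure_induction with
      | zero => exact zero_mem _
      | add x y _ _ hx hy => exact add_mem hx hy
      | smul_mem r x hx =>
        exact Submodule.smul_mem _ (toDPhi r) (Submodule.subset_span hx)
  have := Module.Finite.iff_fg.mpr hfg
  exact Module.Finite.equiv (LinearEquiv.ofInjective f hf).symm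

/-- Ascending chains of unit submodules of a finitely generated unit module stabilize, because the
chain of their intersections with a suitable noetherian `R`-submodule does. -/
theorem exists_forall_eq_of_isUnitModule (L : ℕ →o Submodule (DPhi p a b R) M)
    (hL : ∀ n, ∃ (X : Type v) (_ : AddCommGroup X) (_ : Module (DPhi p a b R) X)
      (f : X →ₗ[DPhi p a b R] M), IsUnitModule p a b R X ∧ LinearMap.range f = L n) :
    ∃ n, ∀ m, n ≤ m → L n = L m := by
  let _ : Module R M := Module.compHom M (toDPhi (p := p) (a := a) (b := b) (R := R))
  have hsmul : ∀ (r : R) (m : M), r • m = toDPhi (p := p) (a := a) (b := b) r • m :=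
    fun _ _ => rfl
  obtain ⟨N, hN, hspan⟩ := exists_fg_forall_span_inter_eq hsmul β hM
  have hspan' : ∀ n, Submodule.span (DPhi p a b R) ((N : Set M) ∩ L n) = L n := fun n => by
    obtain ⟨X, _, _, f, hX, hf⟩ := hL n
    rw [← hf]
    exact hspan f hX
  let L' : ℕ → Submodule R M := fun n => baseSubmodule hsmul (L n)
  have := isNoetherian_of_fg_of_noetherian N hN
  let K : ℕ →o Submodule R N :=
    ⟨fun n => (L' n).comap N.subtype, fun i j hij => Submodule.comap_mono (L.monotone hij)⟩
  obtain ⟨n, hn⟩ := monotone_stabilizes_iff_noetherian.mpr this K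
  refine ⟨n, fun m hm => ?_⟩
  rw [← hspan' n, ← hspan' m]
  congr 1
  ext x
  exact and_congr_right fun hx => SetLike.ext_iff.mp (hn m hm) ⟨x, hx⟩

end Noetherian

/-! ### The category of finitely generated unit modules -/

section Category

variable {p a b : ℕ} {R : Type u} [CommRing R]

theorem function_exact_of_exact {S : ShortComplex (ModuleCat.{v} (DPhi p a b R))} (hS : S.Exact) :
    Function.Exact S.f.hom S.g.hom := fun x =>
  ⟨fun h => S.moduleCat_exact_iff.mp hS x h, by rintro ⟨y, rfl⟩; exact S.moduleCat_zero_apply y⟩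

theorem fguModules_isClosedUnderExtensions (β : FrobDualBasis p a b R) :
    (fguModules.{u, v} p a b R).IsClosedUnderExtensions where
  prop_X₂_of_shortExact {S} hS h₁ h₃ := by
    have hex := function_exact_of_exact hS.exact
    have := h₁.1
    have := h₃.1
    exact ⟨Module.Finite.of_exact hex hS.moduleCat_surjective_g,
      isUnitModule_of_extension S.f.hom S.g.hom β hS.moduleCat_injective_f
        hS.moduleCat_surjective_g hex h₁.2 h₃.2⟩

theorem fguModules_isClosedUnderCokernels (β : FrobDualBasis p a b R) :
    (fguModules.{u, v} p a b R).IsClosedUnderCokernels where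
  cokernels_le := by
    rintro _ ⟨f, k, hk, h₁, h₂⟩
    let S := ShortComplex.mk f k.π k.condition
    have hS : S.Exact := S.exact_of_g_is_cokernel
      (Limits.IsColimit.ofIsoColimit hk (Limits.Cofork.ext (Iso.refl _)))
    have : Epi k.π := Limits.Cofork.IsColimit.epi hk
    have hsurj : Function.Surjective k.π.hom := (ModuleCat.epi_iff_surjective k.π).mp this
    have := h₂.1
    exact ⟨Module.Finite.of_surjective k.π.hom hsurj,
      isUnitModule_of_cokernel f.hom k.π.hom β hsurj (function_exact_of_exact hS) h₁.2 h₂.2⟩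

theorem fguModules_isClosedUnderKernels [ExpChar R p] [IsNoetherianRing R]
    [Module.Finite R (FrobPush p a R R)] (β : FrobDualBasis p a b R) :
    (fguModules.{u, v} p a b R).IsClosedUnderKernels where
  kernels_le := by
    rintro _ ⟨f, k, hk, h₁, h₂⟩
    let S := ShortComplex.mk k.ι f k.condition
    have hS : S.Exact := S.exact_of_f_is_kernel
      (Limits.IsLimit.ofIsoLimit hk (Limits.Fork.ext (Iso.refl _)))
    have : Mono k.ι := Limits.Fork.IsLimit.mono hk
    have hinj : Function.Injective k.ι.hom := (ModuleCat.mono_iff_injective k.ι).mp this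
    have hunit : IsUnitModule p a b R k.pt :=
      isUnitModule_of_kernel k.ι.hom f.hom β hinj (function_exact_of_exact hS) h₁.2 h₂.2
    have := h₁.1
    exact ⟨finite_of_isUnitModule_of_injective β h₁.2 k.ι.hom hinj hunit, hunit⟩

theorem fguModules_isClosedUnderIsomorphisms (β : FrobDualBasis p a b R) :
    (fguModules.{u, v} p a b R).IsClosedUnderIsomorphisms where
  of_iso {X Y} e h := by
    have := h.1
    let E : X ≃ₗ[DPhi p a b R] Y := e.toLinearEquiv
    refine ⟨Module.Finite.equiv E, ?_⟩
    -- the inverse isomorphism is a kernel of the zero map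
    exact isUnitModule_of_kernel E.symm.toLinearMap (0 : X →ₗ[DPhi p a b R] X) β
      E.symm.injective (fun x => ⟨fun _ => E.symm.surjective x, fun _ => rfl⟩) h.2 h.2

theorem fguModules_containsZero (β : FrobDualBasis p a b R) :
    (fguModules.{u, v} p a b R).ContainsZero where
  exists_zero := by
    refine ⟨ModuleCat.of _ PUnit, ModuleCat.isZero_of_subsingleton _, ?_, ?_⟩
    · infer_instance
    · rw [isUnitModule_iff β]
      exact ⟨fun m => ⟨0, Subsingleton.elim _ _⟩, fun _ _ _ => Subsingleton.elim _ _⟩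

theorem fguModules_isClosedUnderFiniteProducts (β : FrobDualBasis p a b R) :
    (fguModules.{u, v} p a b R).IsClosedUnderFiniteProducts := by
  have := fguModules_isClosedUnderExtensions.{u, v} β
  have := fguModules_isClosedUnderIsomorphisms.{u, v} β
  have := fguModules_containsZero.{u, v} β
  have : (fguModules.{u, v} p a b R).IsClosedUnderBinaryProducts := by
    refine ⟨?_⟩
    rintro X ⟨q⟩
    -- a product of two objects is a biproduct, hence an extension of one by the other
    refine ObjectProperty.prop_of_iso _ ?_ (ObjectProperty.prop_biprod _
      (q.prop_diag_obj (.mk .left)) (q.prop_diag_obj (.mk .right)))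
    exact Limits.IsLimit.conePointUniqueUpToIso (Limits.BinaryBiproduct.isLimit _ _)
      ((Limits.IsLimit.postcomposeHomEquiv (Limits.diagramIsoPair q.diag) _).2 q.isLimit)
  exact .mk'

theorem isNoetherianObject_fguModules [ExpChar R p] [IsNoetherianRing R]
    [Module.Finite R (FrobPush p a R R)] (β : FrobDualBasis p a b R)
    (X : (fguModules.{u, v} p a b R).FullSubcategory) : IsNoetherianObject X := by
  have := fguModules_isClosedUnderKernels.{u, v} β
  have := fguModules_containsZero.{u, v} β
  have hmono := (fguModules.{u, v} p a b R).preservesMonomorphisms_ι_of_isNormalEpiCategory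
  have hinj : ∀ {Y Z : (fguModules.{u, v} p a b R).FullSubcategory} (g : Y ⟶ Z) [Mono g],
      Function.Injective g.hom.hom := fun g _ =>
    (ModuleCat.mono_iff_injective g.hom).mp
      (inferInstanceAs (Mono ((fguModules.{u, v} p a b R).ι.map g)))
  rw [isNoetherianObject_iff_monotone_chain_condition]
  intro f
  let L : ℕ →o Submodule (DPhi p a b R) X.obj :=
    { toFun := fun n => LinearMap.range (f n).arrow.hom.hom
      monotone' := by
        intro i j hij
        change LinearMap.range (f i).arrow.hom.hom ≤ LinearMap.range (f j).arrow.hom.hom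
        rw [← Subobject.ofLE_arrow (f.monotone hij)]
        exact LinearMap.range_comp_le_range (Subobject.ofLE _ _ (f.monotone hij)).hom.hom
          (f j).arrow.hom.hom }
  have hX := X.property
  have := hX.1
  obtain ⟨n, hn⟩ := exists_forall_eq_of_isUnitModule β hX.2 L fun n =>
    ⟨_, _, _, (f n).arrow.hom.hom, ((f n : (fguModules.{u, v} p a b R).FullSubcategory)).property.2,
      rfl⟩
  refine ⟨n, fun m hm => le_antisymm (f.monotone hm) ?_⟩
  let E := LinearEquiv.ofInjective (f n).arrow.hom.hom (hinj (f n).arrow)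
  have hle : L m ≤ L n := (hn m hm).ge
  let g := E.symm.toLinearMap ∘ₗ Submodule.inclusion hle ∘ₗ
    LinearMap.rangeRestrict (f m).arrow.hom.hom
  refine Subobject.le_of_comm (ObjectProperty.homMk (ModuleCat.ofHom g)) ?_
  apply ObjectProperty.hom_ext
  apply ModuleCat.hom_ext
  ext x
  have := congrArg Subtype.val (E.apply_symm_apply
    (Submodule.inclusion hle (LinearMap.rangeRestrict (f m).arrow.hom.hom x)))
  exact this

end Category

end PhiMod

end

theorem mainTheorem4 (p : ℕ) [Fact p.Prime] (R : Type u) [CommRing R] [CharP R p]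
    (hR : PhiMod.HasCLFFRT p R) (a b : ℕ) (hab : PhiMod.IsFFRTPair p R a b) :
    (PhiMod.fguModules.{u, v} p a b R).IsClosedUnderKernels ∧
    (PhiMod.fguModules.{u, v} p a b R).IsClosedUnderCokernels ∧
    (PhiMod.fguModules.{u, v} p a b R).IsClosedUnderExtensions ∧
    (∃ A : Abelian (PhiMod.fguModules.{u, v} p a b R).FullSubcategory,
      A.toPreadditive =
        Preadditive.fullSubcategory (PhiMod.fguModules.{u, v} p a b R)) ∧
    (∀ X : (PhiMod.fguModules.{u, v} p a b R).FullSubcategory, IsNoetherianObject X) ∧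
    (∀ M : ModuleCat.{v} (PhiMod.DPhi p a b R), PhiMod.fguModules p a b R M →
      ∀ N : ℕ →o Submodule (PhiMod.DPhi p a b R) M,
        (∀ n, PhiMod.IsUnitModule p a b R (N n)) → ∃ n, ∀ m, n ≤ m → N n = N m) := by
  obtain ⟨β⟩ := PhiMod.nonempty_frobDualBasis p R hR.1 a b hab
  have : IsNoetherianRing R := hR.1.1
  have : Module.Finite R (PhiMod.FrobPush p a R R) := PhiMod.finite_frobPush p R hR.1.2 a
  have hker := PhiMod.fguModules_isClosedUnderKernels.{u, v} β
  have hcoker := PhiMod.fguModules_isClosedUnderCokernels.{u, v} β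
  have := PhiMod.fguModules_containsZero.{u, v} β
  have := PhiMod.fguModules_isClosedUnderFiniteProducts.{u, v} β
  refine ⟨hker, hcoker, PhiMod.fguModules_isClosedUnderExtensions β, ⟨inferInstance, rfl⟩,
    PhiMod.isNoetherianObject_fguModules β, fun M hM N hN => ?_⟩
  have := hM.1
  exact PhiMod.exists_forall_eq_of_isUnitModule β hM.2 N
    fun n => ⟨N n, _, _, (N n).subtype, hN n, (N n).range_subtype⟩
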